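/- **Setting.** A fatgraph $F$ is a finite graph (loops, multiple edges and isolated vertices allowed) with a cyclic order of the half-edges at each vertex; it is identified with the orientable surface obtained by fattening vertices to discs and edges to untwisted bands. Its edges are totally ordered. For a spanning subfatgraph $H$ (same vertices, a subset of the edges) let $v,e(H),k(H),p(H)$ be the numbers of vertices, edges, connected components and boundary components of $H$, and $g(H)$ its genus, $2g(H)=2k(H)+e(H)-v-p(H)$. Let $V,U,R$ be the free trigraded $\mathbb Z$-modules with bases $v_\pm$, $u_\pm$ and $x_0,x_{-2}$ in degrees $(\pm1,0,0)$, $(0,\pm1,0)$ and $(0,0,0),(0,0,-2)$; $\{h\}$ shifts the first degree up by $h$. Let $m:V\otimes V\to V$ be given by $v_+\otimes v_+\mapsto v_+$, $v_\pm\otimes v_\mp\mapsto v_-$, $v_-\otimes v_-\mapsto 0$; let $\Delta:V\to V\otimes V$ be given by $v_+\mapsto v_+\otimes v_-+v_-\otimes v_+$, $v_-\mapsto v_-\otimes v_-$; let $\bar\Delta_h:R^{\otimes h}\to R^{\otimes(h+1)}$ be given by $1\mapsto x_0$ for $h=0$ and $y\otimes x_i\mapsto\sum_{k+l=i}y\otimes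 x_k\otimes x_l$ for $h\ge1$; let $\hat m:U^{\otimes 2g}\to U^{\otimes 2g'}$ be the identity if $g'=g$, and otherwise send a basis element to the sum of all basis elements of the same degree. Let $F_s$ be a fatgraph with signed edges. The height of $H$ is $h_s(H)=e_-(F)-e_-(H)+e_+(H)$. The complex $\mathcal D(F_s)$ has, in homological degree $i$, the direct sum over all $H$ with $h_s(H)=i$ of $V^{\otimes(v+p(H))}\otimes U^{\otimes 2g(H)}\otimes R^{\otimes i}\{i\}$. Its differential is the sum, over the removals of one negative edge of $H$ and the additions of one positive edge to $H$, of the maps $\pm\,1^{\otimes v}\otimes\mu\otimes\hat m\otimes\bar\Delta_i$, where $\mu$ applies $m$ to the two boundary components that merge, or $\Delta$ to the boundary component that splits, and is the identity on all others, and where the sign is $(-1)^a$ with $a$ the number of smaller edges that are negative and not in $H$ or positive and in $H$. Let $HB^i_{(j,k,l)}(\mathcal D(F_s))$ be the degree $(j,k,l)$ part of the $i$-th homology. The chromatic complex $\mathcal C(F)$ of an unsigned fatgraph $F$ is built in the same way from the singly graded modules $V^{\otimes(v+p(H)+2g(H))}\otimes R^{\otimes h}\{h\}$ (with $U$ replaced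 by $V$, and with $V$, $R$ graded by $\pm1$ and $0,-2$), with height $h=e(F)-e(H)$ and the maps for the removals of one edge, and is then shifted by $[-e(F)]$, where $C[s]^i=C^{i-s}$. Its homology is the chromatic homology $H^i_j(\mathcal C(F))$. If $F_s$ has genus $0$, its associated link diagram $L$ has one crossing on each band, joined along the vertex discs (an isolated vertex gives a crossingless circle); the $0$-smoothing of a crossing keeps the band of a negative edge and cuts the band of a positive edge, and the $1$-smoothing does the opposite. For an orientation of $L$ with $n_\pm$ positive and negative crossings, $HK^i_j(L)$ denotes Khovanov homology: the homology of $\widetilde{\mathcal C}(L)[-n_-]\{n_+-2n_-\}$, where $\widetilde{\mathcal C}(L)$ is the cube complex of the modules $V^{\otimes p(S)}\{h(S)\}$ of the states $S$ with $p(S)$ circles and $h(S)$ $1$-smoothings, with maps given by $m$ and $\Delta$. **Theorem 5.4.** Khovanov homology of the associated link and chromatic homology can be recovered from the trigraded homology $HB$: 1. Let $F_s$ be a signed fatgraph of genus $0$ with $v$ vertices and let $L$ be its associated link with any orientation. Then for all $i,j\in\mathbb Z$ $$HB^i_{(j,0,0)}(\mathcal D(F_s))\;\cong\;\bigoplus_{p+q=j}HK^{\,i-n_-}_{\,p+n_+-2n_-}(L)\otimes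 (V^{\otimes v})_q .$$ Moreover $HB$ and $v$ determine the Khovanov homology of $L$ up to the normalization: if $F_s$ and $F'_s$ are signed fatgraphs of genus $0$ with the same number of vertices and $HB^i_{(j,k,l)}(\mathcal D(F_s))\cong HB^i_{(j,k,l)}(\mathcal D(F'_s))$ for all $i,j,k,l$, then for all orientations of the associated links $L,L'$ and all $i,j$ $$HK^{\,i-n_-}_{\,j+n_+-2n_-}(L)\cong HK^{\,i-n'_-}_{\,j+n'_+-2n'_-}(L').$$ 2. Let $F$ be a fatgraph of any genus and let $F_-$ be $F$ with all edges negative. Then for all $i,j\in\mathbb Z$ $$H^i_j(\mathcal C(F))\;\cong\;\bigoplus_{p+q+r=j}HB^{\,i+e(F)}_{(p,q,r)}(\mathcal D(F_-)).$$ -/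

import Mathlib

/-! ### Finitely generated free complexes of graded abelian groups, given by a basis -/

/-- A finitely generated free complex of `Λ`-graded abelian groups with a homogeneous basis `G`:
`height` is the homological degree of a basis element, `degree` its internal degree,
and `coeff x y` is the coefficient of `y` in the differential of `x`. -/
structure GradedComplex (G Λ : Type*) where
  height : G → ℤ
  degree : G → Λ
  coeff : G → G → ℤ

namespace GradedComplex

variable {G Λ : Type*} (C : GradedComplex G Λ)

/-- The part of homological degree `i` and internal degree `t`: the integral combinations of the
basis elements of height `i` and degree `t`. -/
def homogeneous (i : ℤ) (t : Λ) : Submodule ℤ (G → ℤ) where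
  carrier := {f | ∀ x, f x ≠ 0 → C.height x = i ∧ C.degree x = t}
  zero_mem' := fun _ h => absurd rfl h
  add_mem' := by
    intro f g hf hg x hx
    by_cases h : f x = 0
    · refine hg x (fun h0 => hx ?_)
      simp [h, h0]
    · exact hf x h
  smul_mem' := by
    intro c f hf x hx
    refine hf x (fun h0 => hx ?_)
    simp [h0]

/-- The differential: the basis element `x` goes to `∑ y, coeff x y • y`. -/
def diff [Fintype G] : (G → ℤ) →ₗ[ℤ] (G → ℤ) :=
  (Matrix.of C.coeff).vecMulLinear

/-- The cycles of homological degree `i` and internal degree `t`. -/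
def cycles [Fintype G] (i : ℤ) (t : Λ) : Submodule ℤ (G → ℤ) :=
  C.homogeneous i t ⊓ LinearMap.ker C.diff

/-- The boundaries of homological degree `i` and internal degree `t`. -/
def boundaries [Fintype G] (i : ℤ) (t : Λ) : Submodule ℤ (G → ℤ) :=
  (C.homogeneous (i - 1) t).map C.diff

/-- The homology in homological degree `i` and internal degree `t`: cycles modulo boundaries. -/
abbrev Homology [Fintype G] (i : ℤ) (t : Λ) : Type _ :=
  C.cycles i t ⧸ (C.boundaries i t).submoduleOf (C.cycles i t)

/-- `C[a]{b}`: a basis element of height `h` and degree `d` gets height `h + a` and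
degree `d + b`; so `C[a]{b}` has in bidegree `(i, j)` what `C` has in `(i - a, j - b)`. -/
def shift (C : GradedComplex G ℤ) (a b : ℤ) : GradedComplex G ℤ where
  height x := C.height x + a
  degree x := C.degree x + b
  coeff := C.coeff

end GradedComplex

/-! ### The local maps

The basis `v₊, v₋` of `V` (and of its second-grading copy `U`) is `true, false`; the basis
`x₀, x₋₂` of `R` is `true, false`. -/

/-- The degree of a basis element of `V` or `U`. -/
def pmDeg : Bool → ℤ
  | true => 1
  | false => -1

/-- The degree of a basis element of `R`. -/
def rDeg : Bool → ℤ
  | true => 0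
  | false => -2

/-- `mulCoeff x y z` is the coefficient of `z` in the product `x * y` in `V`. -/
def mulCoeff : Bool → Bool → Bool → ℤ
  | true, true, true => 1
  | true, false, false => 1
  | false, true, false => 1
  | _, _, _ => 0

/-- `comulCoeff x y z` is the coefficient of `y ⊗ z` in the coproduct of `x` in `V`. -/
def comulCoeff : Bool → Bool → Bool → ℤ
  | true, true, false => 1
  | true, false, true => 1
  | false, false, false => 1
  | _, _, _ => 0

open Classical in
/-- Two systems of circles on the same set `A` of arcs (the circles are the classes of `r`,
resp. `r'`) which differ by a saddle move that touches exactly the circles through the arcs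
`a` and `b`. `saddleCoeff` is the matrix coefficient, from the labelling `l` of the old circles
to the labelling `l'` of the new ones, of the map that is the identity on the
untouched circles, the multiplication if two circles are merged into one, and the
comultiplication if one circle is split into two. -/
noncomputable def saddleCoeff {A : Type*} (r r' : Setoid A) (a b : A)
    (l : Quotient r → Bool) (l' : Quotient r' → Bool) : ℤ :=
  if ∀ c : A, ¬ r c a → ¬ r c b → l (Quotient.mk r c) = l' (Quotient.mk r' c) then
    if r a b then
      if r' a b then 0
      else comulCoeff (l (Quotient.mk r a)) (l' (Quotient.mk r' a)) (l' (Quotient.mk r' b))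
    else mulCoeff (l (Quotient.mk r a)) (l (Quotient.mk r b)) (l' (Quotient.mk r' a))
  else 0

/-- The genus map between tensor powers of `V` (or `U`), basis elements being written as words:
the identity between equal powers; between different powers, a word goes to the
sum of all words of the same degree. -/
def genusCoeff (u u' : List Bool) : ℤ :=
  if u.length = u'.length then (if u = u' then 1 else 0)
  else (if (u.map pmDeg).sum = (u'.map pmDeg).sum then 1 else 0)

/-- The map from the `h`-th to the `(h + 1)`-st tensor power of `R`: `1 ↦ x₀` for `h = 0`, and
`y ⊗ x_i ↦ ∑_{k + l = i} y ⊗ x_k ⊗ x_l` otherwise. Basis elements are written as words, with the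
tensor factors listed from the last to the first. -/
def rCoeff : List Bool → List Bool → ℤ
  | [], [true] => 1
  | x :: y, k :: l :: z => if z = y ∧ rDeg k + rDeg l = rDeg x then 1 else 0
  | _, _ => 0

/-! ### Fatgraphs -/

/-- A fatgraph with vertex set `V` and edge set `E`. The edge `e` has the two half-edges
`(e, false)` and `(e, true)`; `vert` is the vertex at which a half-edge is attached;
`rot` is the (counterclockwise) cyclic order of the half-edges at each vertex. -/
structure Fatgraph (V E : Type*) where
  vert : E × Bool → V
  rot : Equiv.Perm (E × Bool)
  vert_rot : ∀ d, vert (rot d) = vert d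
  sameCycle_of_vert_eq : ∀ d d', vert d = vert d' → rot.SameCycle d d'

namespace Fatgraph

variable {V E : Type*} (F : Fatgraph V E)

/-- The vertices without half-edges. -/
abbrev Isolated : Type _ := {w : V // ∀ d, F.vert d ≠ w}

/-- For a spanning subfatgraph with edge set `H`, the other half-edge of the edge of `d` if that
edge is in `H`, and `d` itself if it is not. -/
def cross [DecidableEq E] (H : Finset E) (d : E × Bool) : E × Bool :=
  if d.1 ∈ H then (d.1, !d.2) else d

theorem cross_involutive [DecidableEq E] (H : Finset E) :
    Function.Involutive (cross (E := E) H) := by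
  rintro ⟨e, b⟩
  by_cases h : e ∈ H <;> simp [cross, h]

/-- How one walks along the boundary of the surface of the spanning subfatgraph with edge set
`H`. The circle around an island of `F` is cut by the half-edges into arcs; the arc from `d` to
`rot d` is named `d`. From the end of that arc the boundary goes along the side of the bridge of
`rot d` to the arc at the other end of the bridge if this bridge is in `H`; otherwise it
stays on the same island and goes on with the arc `rot d`.
A vertex without half-edges has one boundary circle of its own. -/
def walk [DecidableEq E] (H : Finset E) : Equiv.Perm ((E × Bool) ⊕ F.Isolated) :=
  Equiv.sumCongr (F.rot.trans (cross_involutive H).toPerm) (Equiv.refl _)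

/-- Arcs on the same boundary component of the spanning subfatgraph `H`. -/
def boundarySetoid [DecidableEq E] (H : Finset E) : Setoid ((E × Bool) ⊕ F.Isolated) :=
  Equiv.Perm.SameCycle.setoid (F.walk H)

/-- The boundary components of the surface of the spanning subfatgraph `H`. -/
abbrev Boundary [DecidableEq E] (H : Finset E) : Type _ := Quotient (F.boundarySetoid H)

/-- The connected components of the spanning subfatgraph `H`. -/
abbrev Component (H : Finset E) : Type _ :=
  Quot (fun u w : V => ∃ e ∈ H, F.vert (e, false) = u ∧ F.vert (e, true) = w)

/-- The genus `g` of the surface of the spanning subfatgraph `H`, from Euler's formula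
`v - e + p = 2 k - 2 g` with `v` vertices, `e` edges, `p` boundary components and `k` connected
components. -/
noncomputable def genus [DecidableEq E] (H : Finset E) : ℕ :=
  (2 * Nat.card (F.Component H) + H.card - (Nat.card V + Nat.card (F.Boundary H))) / 2

/-- Basis of the chromatic complex: a spanning subfatgraph `H` with a basis element of
`V^{⊗ v} ⊗ V^{⊗ p(H)} ⊗ V^{⊗ 2 g(H)} ⊗ R^{⊗ h(H)}`, where `h(H) = e(F) - e(H)`. -/
abbrev ChromaticGen [Fintype E] [DecidableEq E] : Type _ :=
  Σ H : Finset E, (V → Bool) × (F.Boundary H → Bool) × List.Vector Bool (2 * F.genus H) ×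
    List.Vector Bool (Fintype.card E - H.card)

noncomputable instance [Fintype V] [Fintype E] [DecidableEq E] : Fintype F.ChromaticGen :=
  Fintype.ofFinite _

open Classical in
/-- The unnormalized chromatic complex: the module
`V^{⊗ (v + p + 2g)} ⊗ R^{⊗ h} {h}` of a spanning subfatgraph `H` is put in height `h`, and the
differential is the signed sum over the removals of one bridge. -/
noncomputable def chromaticComplexUnnormalized [Fintype V] [Fintype E] [LinearOrder E] :
    GradedComplex F.ChromaticGen ℤ where
  height x := (Fintype.card E : ℤ) - x.1.card
  degree x := (∑ w, pmDeg (x.2.1 w)) + (∑ᶠ c, pmDeg (x.2.2.1 c)) +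
    (x.2.2.2.1.toList.map pmDeg).sum + (x.2.2.2.2.toList.map rDeg).sum +
    ((Fintype.card E : ℤ) - x.1.card)
  coeff x y := ∑ e : E,
    if e ∈ x.1 ∧ y.1 = x.1.erase e then
      (-1) ^ (Finset.univ.filter (fun f => f < e ∧ f ∉ x.1)).card *
      (if x.2.1 = y.2.1 then 1 else 0) *
      saddleCoeff (F.boundarySetoid x.1) (F.boundarySetoid y.1)
        (Sum.inl (e, false)) (Sum.inl (e, true)) x.2.2.1 y.2.2.1 *
      genusCoeff x.2.2.2.1.toList y.2.2.2.1.toList *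
      rCoeff x.2.2.2.2.toList y.2.2.2.2.toList
    else 0

/-- The chromatic complex: the unnormalized one with the height shift `[-e(F)]`. -/
noncomputable def chromaticComplex [Fintype V] [Fintype E] [LinearOrder E] :
    GradedComplex F.ChromaticGen ℤ :=
  F.chromaticComplexUnnormalized.shift (-(Fintype.card E : ℤ)) 0

end Fatgraph

/-! ### Signed fatgraphs and the trigraded complex -/

/-- A fatgraph whose edges carry signs: those in `positive` carry `+`, the others `-`. -/
structure SignedFatgraph (V E : Type*) extends Fatgraph V E where
  positive : Finset E

/-- A fatgraph as a signed fatgraph all of whose edges are negative. -/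
def Fatgraph.allNegative {V E : Type*} (F : Fatgraph V E) : SignedFatgraph V E where
  toFatgraph := F
  positive := ∅

namespace SignedFatgraph

variable {V E : Type*} (F : SignedFatgraph V E)

/-- The edges that count for the height of the spanning subfatgraph `H`: the negative edges
that are not in `H` and the positive edges that are in `H`. -/
def switched [Fintype E] [DecidableEq E] (H : Finset E) : Finset E :=
  Finset.univ.filter (fun e => (e ∉ F.positive ∧ e ∉ H) ∨ (e ∈ F.positive ∧ e ∈ H))

/-- The height `h_s(H) = e₋(F) - e₋(H) + e₊(H)`. -/
def height [Fintype E] [DecidableEq E] (H : Finset E) : ℕ := (F.switched H).card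

/-- Basis of the trigraded complex: a spanning subfatgraph `H` with a basis element of
`V^{⊗ v} ⊗ V^{⊗ p(H)} ⊗ U^{⊗ 2 g(H)} ⊗ R^{⊗ h_s(H)}`. -/
abbrev Gen [Fintype E] [DecidableEq E] : Type _ :=
  Σ H : Finset E, (V → Bool) × (F.Boundary H → Bool) × List.Vector Bool (2 * F.genus H) ×
    List.Vector Bool (F.height H)

noncomputable instance [Fintype V] [Fintype E] [DecidableEq E] : Fintype F.Gen :=
  Fintype.ofFinite _

/-- `H'` arises from `H` by switching the edge `e` upwards: a negative edge is removed, a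
positive edge is added. -/
def Step [DecidableEq E] (e : E) (H H' : Finset E) : Prop :=
  (e ∉ F.positive ∧ e ∈ H ∧ H' = H.erase e) ∨ (e ∈ F.positive ∧ e ∉ H ∧ H' = insert e H)

open Classical in
/-- The trigraded complex `D(F_s)`: the module
`V^{⊗ (v + p(H))} ⊗ U^{⊗ 2 g(H)} ⊗ R^{⊗ h_s(H)} {h_s(H)}` of a spanning subfatgraph `H` is put in
height `h_s(H)`; the generators of `V`, `U`, `R` have degrees `(±1,0,0)`, `(0,±1,0)` and
`(0,0,0)`, `(0,0,-2)`, and the shift `{h}` acts on the first degree. -/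
noncomputable def complex [Fintype V] [Fintype E] [LinearOrder E] :
    GradedComplex F.Gen (ℤ × ℤ × ℤ) where
  height x := F.height x.1
  degree x := ((∑ w, pmDeg (x.2.1 w)) + (∑ᶠ c, pmDeg (x.2.2.1 c)) + F.height x.1,
    (x.2.2.2.1.toList.map pmDeg).sum, (x.2.2.2.2.toList.map rDeg).sum)
  coeff x y := ∑ e : E,
    if F.Step e x.1 y.1 then
      (-1) ^ ((F.switched x.1).filter (fun f => f < e)).card *
      (if x.2.1 = y.2.1 then 1 else 0) *
      saddleCoeff (F.boundarySetoid x.1) (F.boundarySetoid y.1)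
        (Sum.inl (e, false)) (Sum.inl (e, true)) x.2.2.1 y.2.2.1 *
      genusCoeff x.2.2.2.1.toList y.2.2.2.1.toList *
      rCoeff x.2.2.2.2.toList y.2.2.2.2.toList
    else 0

/-- The trigraded homology `HB^i_{(j,k,l)}(D(F_s))`. -/
abbrev HB [Fintype V] [Fintype E] [LinearOrder E] (i j k l : ℤ) : Type _ :=
  F.complex.Homology i (j, k, l)

end SignedFatgraph

/-- The chromatic homology `H^i_j(C(F))`. -/
abbrev Fatgraph.ChromaticHomology {V E : Type*} (F : Fatgraph V E) [Fintype V] [Fintype E]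
    [LinearOrder E] (i j : ℤ) : Type _ :=
  F.chromaticComplex.Homology i j

/-! ### Link diagrams and Khovanov homology -/

/-- A link diagram with crossings `X` and crossingless circle components `C`, as a planar diagram
code: the four ends at a crossing `x` are `(x, 0)`, `(x, 1)`, `(x, 2)`, `(x, 3)` in
counterclockwise order, where `0`, `2` are the ends of the lower strand and `1`, `3` those of
the upper strand; `glue` matches the two ends of each arc. -/
structure LinkDiagram (X C : Type*) where
  glue : X × Fin 4 → X × Fin 4
  glue_glue : ∀ a, glue (glue a) = a
  glue_ne : ∀ a, glue a ≠ a

namespace LinkDiagram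

variable {X C : Type*} (L : LinkDiagram X C)

/-- An orientation of the strands: `incoming a` says that the strand at the end `a` points into
the crossing. Every strand goes through the crossings and along the arcs consistently. -/
structure Orientation where
  incoming : X × Fin 4 → Bool
  incoming_opposite : ∀ x k, incoming (x, k + 2) = !incoming (x, k)
  incoming_glue : ∀ a, incoming (L.glue a) = !incoming a

variable {L} in
/-- The number `n₊` of positive crossings: those where, looking along the lower strand, the upper
strand passes from left to right. -/
def Orientation.nPos [Fintype X] (o : L.Orientation) : ℕ :=
  (Finset.univ.filter (fun x => o.incoming (x, 0) = o.incoming (x, 3))).card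

variable {L} in
/-- The number `n₋` of negative crossings. -/
def Orientation.nNeg [Fintype X] (o : L.Orientation) : ℕ :=
  (Finset.univ.filter (fun x => o.incoming (x, 0) ≠ o.incoming (x, 3))).card

/-- The smoothing of a crossing: the `0`-smoothing (`false`) joins the ends `0`, `1` and `2`, `3`,
the `1`-smoothing (`true`) joins `0`, `3` and `1`, `2`. -/
def smooth : Bool → Fin 4 → Fin 4
  | false => ![1, 0, 3, 2]
  | true => ![3, 2, 1, 0]

/-- Ends that are joined directly in the state `s`, by an arc or by a smoothing. -/
inductive Joined (s : X → Bool) : (X × Fin 4) ⊕ C → (X × Fin 4) ⊕ C → Prop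
  | arc (a : X × Fin 4) : Joined s (Sum.inl a) (Sum.inl (L.glue a))
  | smoothing (x : X) (k : Fin 4) : Joined s (Sum.inl (x, k)) (Sum.inl (x, smooth (s x) k))

/-- Ends on the same circle of the state `s`. -/
def circleSetoid (s : X → Bool) : Setoid ((X × Fin 4) ⊕ C) :=
  Relation.EqvGen.setoid (L.Joined s)

/-- The circles of the state `s`. -/
abbrev Circle (s : X → Bool) : Type _ := Quotient (L.circleSetoid s)

/-- Basis of the Khovanov complex: a state with a basis element of `V^{⊗ p}`, `p` the number of
its circles. -/
abbrev KhGen : Type _ := Σ s : X → Bool, (L.Circle s → Bool)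

noncomputable instance [Fintype X] [Finite C] : Fintype L.KhGen := Fintype.ofFinite _

/-- The number of `1`-smoothings in the state `s`. -/
def height [Fintype X] (s : X → Bool) : ℕ := (Finset.univ.filter (fun x => s x = true)).card

open Classical in
/-- The unnormalized Khovanov complex: the module `V^{⊗ p(s)} {h(s)}` of a state `s` is put in
height `h(s)`, and the differential is the signed sum over the changes of one `0`-smoothing into
a `1`-smoothing. -/
noncomputable def khovanovUnnormalized [Fintype X] [LinearOrder X] [Finite C] :
    GradedComplex L.KhGen ℤ where
  height a := height a.1
  degree a := (∑ᶠ c, pmDeg (a.2 c)) + height a.1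
  coeff a b := ∑ x : X,
    if a.1 x = false ∧ b.1 = Function.update a.1 x true then
      (-1) ^ (Finset.univ.filter (fun y => y < x ∧ a.1 y = true)).card *
      saddleCoeff (L.circleSetoid a.1) (L.circleSetoid b.1)
        (Sum.inl (x, 0)) (Sum.inl (x, 2)) a.2 b.2
    else 0

/-- The Khovanov homology `HK^i_j` of an oriented link diagram: the homology of the unnormalized
complex shifted by `[-n₋]{n₊ - 2 n₋}`. -/
abbrev HK [Fintype X] [LinearOrder X] [Finite C] (o : L.Orientation) (i j : ℤ) : Type _ :=
  (L.khovanovUnnormalized.shift (-(o.nNeg : ℤ)) ((o.nPos : ℤ) - 2 * o.nNeg)).Homology i j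

end LinkDiagram

/-! ### The link associated with a signed fatgraph -/

namespace SignedFatgraph

variable {V E : Type*} [DecidableEq E] (F : SignedFatgraph V E)

/-- There is one crossing on each bridge. Of its four ends, two lie next to each half-edge `d`:
one on the arc of the island that follows `d` in the cyclic order (`after`) and one
on the arc that precedes `d` (`before`). In counterclockwise order these are, around the crossing,
after and before `(e, false)`, then after and before `(e, true)`. They are numbered in this order,
starting with `twist e`, so that the ends `1`, `3` of the upper strand depend on the sign of `e`. -/
def twist (e : E) : Fin 4 := if e ∈ F.positive then 0 else 1

/-- The end of the crossing that follows the half-edge `d`. The `0`-smoothing is the one that cuts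
the bridge if the edge is positive, and the one that keeps the bridge if it is negative. -/
def after (d : E × Bool) : E × Fin 4 := (d.1, (if d.2 then 2 else 0) + F.twist d.1)

/-- The end of the crossing that precedes the half-edge `d`. -/
def before (d : E × Bool) : E × Fin 4 := (d.1, (if d.2 then 3 else 1) + F.twist d.1)

/-- The strand at the end `a` of a crossing runs along an arc of an island to the next
half-edge: the end after `d` is joined to the end before `rot d`. -/
def linkGlue (a : E × Fin 4) : E × Fin 4 :=
  match a.2 - F.twist a.1 with
  | 0 => F.before (F.rot (a.1, false))
  | 1 => F.after (F.rot.symm (a.1, false))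
  | 2 => F.before (F.rot (a.1, true))
  | 3 => F.after (F.rot.symm (a.1, true))

theorem linkGlue_after (d : E × Bool) : F.linkGlue (F.after d) = F.before (F.rot d) := by
  obtain ⟨e, b⟩ := d
  cases b <;> simp [linkGlue, after]

theorem linkGlue_before (d : E × Bool) : F.linkGlue (F.before d) = F.after (F.rot.symm d) := by
  obtain ⟨e, b⟩ := d
  cases b <;> simp [linkGlue, before]

theorem eq_after_or_before (a : E × Fin 4) : ∃ d, a = F.after d ∨ a = F.before d := by
  obtain ⟨e, k⟩ := a
  have h : k = (k - F.twist e) + F.twist e := by simp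
  generalize k - F.twist e = m at h
  subst h
  fin_cases m
  · exact ⟨(e, false), Or.inl rfl⟩
  · exact ⟨(e, false), Or.inr rfl⟩
  · exact ⟨(e, true), Or.inl rfl⟩
  · exact ⟨(e, true), Or.inr rfl⟩

theorem after_ne_before (d d' : E × Bool) : F.after d ≠ F.before d' := by
  obtain ⟨e, b⟩ := d
  obtain ⟨e', b'⟩ := d'
  intro h
  have h1 : e = e' := congrArg Prod.fst h
  subst h1
  have h2 := congrArg Prod.snd h
  simp only [after, before, add_left_inj] at h2
  revert h2
  cases b <;> cases b' <;> simp

/-- The link diagram associated with a signed fatgraph: one crossing on each bridge, joined along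
the islands; an island without bridges gives a circle without crossings. -/
def link : LinkDiagram E F.Isolated where
  glue := F.linkGlue
  glue_glue a := by
    obtain ⟨d, rfl | rfl⟩ := F.eq_after_or_before a
    · simp [linkGlue_after, linkGlue_before]
    · simp [linkGlue_after, linkGlue_before]
  glue_ne a := by
    obtain ⟨d, rfl | rfl⟩ := F.eq_after_or_before a
    · rw [linkGlue_after]
      exact (F.after_ne_before _ _).symm
    · rw [linkGlue_before]
      exact F.after_ne_before _ _

end SignedFatgraph

/-! ### Comparing the homology of graded complexes -/

namespace GradedComplex

variable {G G' Λ Λ' : Type*}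

/-! All complexes here carry explicit bases, so every comparison is a comparison of matrix entries.
Two tools suffice. If a homogeneous part of one complex sits in another as a set of basis elements
with the same coefficients, the homologies agree (`homologyEquiv_of_embedding`). If a differential
respects a finer grading, the homology splits accordingly (`homologyEquiv_directSum`).

The topological input is that inserting an edge multiplies the boundary permutation by a
transposition (`Fatgraph.walk_insert`), which merges two cycles or splits one. So every differential
is made of saddle maps. These lower the circle degree by one, the shift by the height restores it,
and the differential of `D` preserves all three degrees.

Khovanov homology. Twice the genus is monotone in the edge set, so genus zero of the whole surface
kills all `U`-factors. Third degree zero forces every `R`-factor to be `x₀`, and the map on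
`R`-powers has coefficient one there. What remains is the Khovanov cube tensored with `V^{⊗ v}`:
states correspond to spanning subfatgraphs, and circles to boundary components
(`boundaryEquivCircle`, `saddleCoeff_link`). Since the differential is the identity on `V^{⊗ v}`,
this part of `HB` splits over the basis of that factor.

Conversely, `HB` gives a sum of copies of Khovanov homology shifted by the degrees of `V^{⊗ v}`. The
top shift occurs once, so one works downwards from the degrees where everything vanishes and cancels
the summands already known. Cancellation holds for finitely generated abelian groups because such a
group is determined by its numbers of homomorphisms to finite cyclic groups, and these numbers are
nonzero and multiplicative.

Chromatic homology. For negative edges the chromatic complex is `D` with its three degrees added up,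
so its homology is the sum over all triples with the given total. -/

theorem mem_homogeneous (C : GradedComplex G Λ) {i : ℤ} {t : Λ} {f : G → ℤ} :
    f ∈ C.homogeneous i t ↔ ∀ x, f x ≠ 0 → C.height x = i ∧ C.degree x = t := Iff.rfl

theorem diff_apply [Fintype G] (C : GradedComplex G Λ) (f : G → ℤ) (y : G) :
    C.diff f y = ∑ x, f x * C.coeff x y := by
  simp [diff, Matrix.vecMul, dotProduct]

theorem mem_cycles [Fintype G] (C : GradedComplex G Λ) {i : ℤ} {t : Λ} {f : G → ℤ} :
    f ∈ C.cycles i t ↔ f ∈ C.homogeneous i t ∧ C.diff f = 0 := by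
  simp [cycles]

/-- The inclusion `ι` of a subset of a basis, on integral combinations. -/
noncomputable abbrev extendByZero (ι : G → G') : (G → ℤ) →ₗ[ℤ] (G' → ℤ) :=
  Function.ExtendByZero.linearMap ℤ ι

theorem extendByZero_apply {ι : G → G'} (hι : ι.Injective) (f : G → ℤ) (x : G) :
    extendByZero ι f (ι x) = f x :=
  hι.extend_apply f 0 x

theorem extendByZero_apply_of_notMem {ι : G → G'} (f : G → ℤ) {y : G'}
    (hy : y ∉ Set.range ι) : extendByZero ι f y = 0 :=
  Function.extend_apply' _ _ _ hy

theorem extendByZero_injective {ι : G → G'} (hι : ι.Injective) :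
    Function.Injective (extendByZero ι) := fun f g h => by
  ext x
  rw [← extendByZero_apply hι f, h, extendByZero_apply hι]

/-- If the part of internal degree `t'` of `C'` is, up to a shift `s` of the height, the part of
internal degree `t` of `C`, then the homology groups in these degrees agree. -/
theorem homologyEquiv_of_embedding [Fintype G] [Fintype G'] (C : GradedComplex G Λ)
    (C' : GradedComplex G' Λ') (t : Λ) (t' : Λ') (s : ℤ) (ι : G → G') (hι : ι.Injective)
    (hheight : ∀ x, C'.height (ι x) = C.height x + s)
    (hdeg : ∀ x, C'.degree (ι x) = t' ↔ C.degree x = t)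
    (hrange : ∀ y, C'.degree y = t' → y ∈ Set.range ι)
    (hcoeff : ∀ x y, C'.coeff (ι x) (ι y) = C.coeff x y)
    (hpres : ∀ x y, C'.coeff x y ≠ 0 → C'.degree x = C'.degree y) (i i' : ℤ) (hi : i' = i + s) :
    Nonempty (C.Homology i t ≃+ C'.Homology i' t') := by
  classical
  subst hi
  have hhom : ∀ (i : ℤ) (f : G → ℤ),
      extendByZero ι f ∈ C'.homogeneous (i + s) t' ↔ f ∈ C.homogeneous i t := by
    intro i f
    rw [mem_homogeneous, mem_homogeneous]
    constructor
    · intro h x hx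
      have := h (ι x) (by rwa [extendByZero_apply hι])
      rw [hheight, hdeg] at this
      exact ⟨by linarith [this.1], this.2⟩
    · intro h y hy
      by_cases hy' : y ∈ Set.range ι
      · obtain ⟨x, rfl⟩ := hy'
        rw [extendByZero_apply hι] at hy
        rw [hheight, hdeg, (h x hy).1]
        exact ⟨rfl, (h x hy).2⟩
      · exact absurd (extendByZero_apply_of_notMem f hy') hy
  -- By `hrange`, a chain of degree `t'` is supported on the image of `ι`, so restriction to that
  -- image loses nothing.
  have hsurj : ∀ (i : ℤ) (g : G' → ℤ), g ∈ C'.homogeneous (i + s) t' →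
      ∃ f, extendByZero ι f = g := by
    intro i g hg
    refine ⟨g ∘ ι, funext fun y => ?_⟩
    by_cases hy : y ∈ Set.range ι
    · obtain ⟨x, rfl⟩ := hy
      rw [extendByZero_apply hι, Function.comp]
    · rw [extendByZero_apply_of_notMem _ hy]
      by_contra h
      exact hy (hrange y (hg y (Ne.symm h)).2)
  have hdiff : ∀ (i : ℤ) (f : G → ℤ), f ∈ C.homogeneous i t →
      C'.diff (extendByZero ι f) = extendByZero ι (C.diff f) := by
    intro i f hf
    ext y
    have key : C'.diff (extendByZero ι f) y = ∑ x, f x * C'.coeff (ι x) y := by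
      rw [diff_apply]
      refine (Finset.sum_of_injOn ι hι.injOn (fun _ _ => Finset.mem_coe.2 (Finset.mem_univ _))
        ?_ ?_).symm
      · intro z _ hz
        rw [extendByZero_apply_of_notMem, zero_mul]
        rintro ⟨x, rfl⟩
        exact hz ⟨x, Finset.mem_coe.2 (Finset.mem_univ _), rfl⟩
      · intro x _
        rw [extendByZero_apply hι]
    rw [key]
    by_cases hy : y ∈ Set.range ι
    · obtain ⟨z, rfl⟩ := hy
      rw [extendByZero_apply hι, diff_apply]
      simp only [hcoeff]
    · rw [extendByZero_apply_of_notMem _ hy]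
      refine Finset.sum_eq_zero fun x _ => ?_
      -- A nonzero entry would, by `hpres`, put `y` in degree `t'` and hence into the image of `ι`.
      by_contra h
      obtain ⟨h1, h2⟩ := mul_ne_zero_iff.1 h
      refine hy (hrange y ?_)
      rw [← hpres _ _ h2, hdeg]
      exact (hf x h1).2
  have hcyc : (C.cycles i t).map (extendByZero ι) = C'.cycles (i + s) t' := by
    ext g
    simp only [Submodule.mem_map, mem_cycles]
    constructor
    · rintro ⟨f, ⟨h1, h2⟩, rfl⟩
      exact ⟨(hhom i f).2 h1, by rw [hdiff i f h1, h2, map_zero]⟩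
    · rintro ⟨h1, h2⟩
      obtain ⟨f, rfl⟩ := hsurj i g h1
      have h3 := (hhom i f).1 h1
      exact ⟨f, ⟨h3, extendByZero_injective hι (by rw [← hdiff i f h3, h2, map_zero])⟩, rfl⟩
  have hbd : (C.boundaries i t).map (extendByZero ι) = C'.boundaries (i + s) t' := by
    have e : i + s - 1 = i - 1 + s := by ring
    ext g
    simp only [Submodule.mem_map, boundaries, e]
    constructor
    · rintro ⟨_, ⟨f, hf, rfl⟩, rfl⟩
      exact ⟨_, (hhom _ f).2 hf, hdiff _ f hf⟩
    · rintro ⟨g, hg, rfl⟩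
      obtain ⟨f, rfl⟩ := hsurj _ g hg
      have h3 := (hhom _ f).1 hg
      exact ⟨_, ⟨f, h3, rfl⟩, (hdiff _ f h3).symm⟩
  let e : C.cycles i t ≃ₗ[ℤ] C'.cycles (i + s) t' :=
    (Submodule.equivMapOfInjective _ (extendByZero_injective hι) _).trans
      (LinearEquiv.ofEq _ _ hcyc)
  have he : ∀ f, ((e f : C'.cycles (i + s) t') : G' → ℤ) = extendByZero ι f := fun f => rfl
  refine ⟨(Submodule.Quotient.equiv _ _ e ?_).toAddEquiv⟩
  ext g
  simp only [Submodule.mem_map, Submodule.submoduleOf, Submodule.mem_comap, Submodule.subtype_apply]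
  rw [← hbd]
  constructor
  · rintro ⟨f, hf, rfl⟩
    exact ⟨f, hf, rfl⟩
  · rintro ⟨f, hf, hfg⟩
    refine ⟨e.symm g, ?_, e.apply_symm_apply g⟩
    have : ((e.symm g : C.cycles i t) : G → ℤ) = f := by
      apply extendByZero_injective hι
      rw [hfg, ← he, e.apply_symm_apply]
    rwa [this]

/-! #### Decomposition according to a finer grading -/

/-- The part of internal degree `t` of a chain. -/
noncomputable def proj (C : GradedComplex G Λ) (t : Λ) : (G → ℤ) →ₗ[ℤ] (G → ℤ) where
  toFun f := Set.indicator {x | C.degree x = t} f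
  map_add' f g := Set.indicator_add _ f g
  map_smul' c f := Set.indicator_const_smul _ c f

theorem proj_apply_of_eq (C : GradedComplex G Λ) (f : G → ℤ) {t : Λ} {x : G}
    (h : C.degree x = t) : C.proj t f x = f x :=
  Set.indicator_of_mem (s := {x | C.degree x = t}) h f

theorem proj_apply_of_ne (C : GradedComplex G Λ) (f : G → ℤ) {t : Λ} {x : G}
    (h : C.degree x ≠ t) : C.proj t f x = 0 :=
  Set.indicator_of_notMem (s := {x | C.degree x = t}) h f

/-- The matrix of the differential is block diagonal with respect to the degree. This makes the
projections chain maps. -/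
theorem diff_proj [Fintype G] (C : GradedComplex G Λ)
    (hpres : ∀ x y, C.coeff x y ≠ 0 → C.degree x = C.degree y) (t : Λ) (f : G → ℤ) :
    C.diff (C.proj t f) = C.proj t (C.diff f) := by
  ext y
  by_cases hy : C.degree y = t
  · rw [proj_apply_of_eq _ _ hy, diff_apply, diff_apply]
    refine Finset.sum_congr rfl fun x _ => ?_
    by_cases hx : C.degree x = t
    · rw [proj_apply_of_eq _ _ hx]
    · rw [show C.coeff x y = 0 by
        by_contra h
        exact hx ((hpres x y h).trans hy), mul_zero, mul_zero]
  · rw [proj_apply_of_ne _ _ hy, diff_apply]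
    refine Finset.sum_eq_zero fun x _ => ?_
    by_cases hx : C.degree x = t
    · rw [show C.coeff x y = 0 by
        by_contra h
        exact hy ((hpres x y h).symm.trans hx), mul_zero]
    · rw [proj_apply_of_ne _ _ hx, zero_mul]

theorem proj_eq_self (C : GradedComplex G Λ) {i : ℤ} {t : Λ} {f : G → ℤ}
    (hf : f ∈ C.homogeneous i t) : C.proj t f = f := by
  ext x
  by_cases hx : C.degree x = t
  · exact proj_apply_of_eq _ _ hx
  · rw [proj_apply_of_ne _ _ hx]
    by_contra h
    exact hx (hf x (Ne.symm h)).2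

theorem proj_eq_zero (C : GradedComplex G Λ) {i : ℤ} {t u : Λ} (htu : t ≠ u) {f : G → ℤ}
    (hf : f ∈ C.homogeneous i u) : C.proj t f = 0 := by
  ext x
  by_cases hx : C.degree x = t
  · rw [proj_apply_of_eq _ _ hx]
    by_contra h
    exact htu (hx.symm.trans (hf x h).2)
  · rw [proj_apply_of_ne _ _ hx, Pi.zero_apply]

/-- The linear map on homology induced by a chain map. -/
noncomputable def homologyMap [Fintype G] (C : GradedComplex G Λ) (C' : GradedComplex G Λ')
    (φ : (G → ℤ) →ₗ[ℤ] (G → ℤ)) (i : ℤ) (t : Λ) (t' : Λ')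
    (hc : ∀ f ∈ C.cycles i t, φ f ∈ C'.cycles i t')
    (hb : ∀ f ∈ C.boundaries i t, φ f ∈ C'.boundaries i t') :
    C.Homology i t →ₗ[ℤ] C'.Homology i t' :=
  Submodule.mapQ _ _ (φ.restrict hc) fun _ hf => hb _ hf

/-- A complex whose differential preserves a finer grading: its homology is the direct sum of the
homology groups of the finer grading. -/
theorem homologyEquiv_directSum [Fintype G] (C : GradedComplex G Λ) (C' : GradedComplex G Λ')
    (hheight : C'.height = C.height) (hcoeff : C'.coeff = C.coeff)
    (hpres : ∀ x y, C.coeff x y ≠ 0 → C.degree x = C.degree y)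
    {I : Type*} (τ : I → Λ) (hτ : τ.Injective) (i : ℤ) (t' : Λ')
    (hdeg : ∀ x, C'.degree x = t' ↔ ∃ k, C.degree x = τ k) :
    Nonempty (C'.Homology i t' ≃+ DirectSum I fun k => C.Homology i (τ k)) := by
  classical
  have hdiff : C'.diff = C.diff := by simp only [diff, hcoeff]
  have hle : ∀ (i : ℤ) k, C.homogeneous i (τ k) ≤ C'.homogeneous i t' := by
    intro i k f hf x hx
    rw [hheight, hdeg]
    exact ⟨(hf x hx).1, k, (hf x hx).2⟩
  have hprojmem : ∀ (i : ℤ) k (f : G → ℤ), f ∈ C'.homogeneous i t' →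
      C.proj (τ k) f ∈ C.homogeneous i (τ k) := by
    intro i k f hf x hx
    by_cases h : C.degree x = τ k
    · rw [proj_apply_of_eq _ _ h] at hx
      exact ⟨hheight ▸ (hf x hx).1, h⟩
    · exact absurd (proj_apply_of_ne _ _ h) hx
  let incl (k : I) : C.Homology i (τ k) →ₗ[ℤ] C'.Homology i t' :=
    homologyMap C C' LinearMap.id i (τ k) t'
      (fun f hf => by
        rw [mem_cycles] at hf ⊢
        exact ⟨hle _ _ hf.1, by rw [hdiff]; exact hf.2⟩)
      (by
        rintro _ ⟨g, hg, rfl⟩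
        exact ⟨g, hle _ _ hg, by rw [hdiff]; rfl⟩)
  let pr (k : I) : C'.Homology i t' →ₗ[ℤ] C.Homology i (τ k) :=
    homologyMap C' C (C.proj (τ k)) i t' (τ k)
      (fun f hf => by
        rw [mem_cycles] at hf ⊢
        refine ⟨hprojmem _ _ _ hf.1, ?_⟩
        rw [diff_proj C hpres, ← hdiff, hf.2, map_zero])
      (by
        rintro _ ⟨g, hg, rfl⟩
        exact ⟨_, hprojmem _ k _ hg, by rw [hdiff, diff_proj C hpres]⟩)
  let Φ : (DirectSum I fun k => C.Homology i (τ k)) →ₗ[ℤ] C'.Homology i t' :=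
    DirectSum.toModule ℤ I _ incl
  -- The projections recover the components, which gives injectivity of `Φ`. For surjectivity a
  -- cycle is the sum of its homogeneous parts.
  have hpr : ∀ k, pr k ∘ₗ Φ = DirectSum.component ℤ I _ k := by
    intro k
    refine DirectSum.linearMap_ext _ fun l => ?_
    ext ⟨f, hf⟩
    simp only [LinearMap.comp_apply, Φ, DirectSum.toModule_lof]
    have hf' := (mem_cycles C).1 hf
    by_cases hkl : l = k
    · subst hkl
      rw [DirectSum.component.lof_self]
      refine congrArg (Submodule.Quotient.mk) (Subtype.ext ?_)
      exact proj_eq_self C hf'.1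
    · rw [DirectSum.component.of, dif_neg hkl]
      refine (Submodule.Quotient.mk_eq_zero _).2 ?_
      have : C.proj (τ k) f = 0 := proj_eq_zero C (fun h => hkl (hτ h).symm) hf'.1
      simp only [Submodule.submoduleOf, Submodule.mem_comap, Submodule.subtype_apply]
      change C.proj (τ k) f ∈ _
      rw [this]
      exact zero_mem _
  have hinj : Function.Injective Φ := by
    intro z w hzw
    refine DirectSum.ext_component ℤ fun k => ?_
    rw [← hpr k, LinearMap.comp_apply, hzw, LinearMap.comp_apply]
  have hsurj : Function.Surjective Φ := by
    intro z
    obtain ⟨⟨f, hf⟩, rfl⟩ := Submodule.Quotient.mk_surjective _ z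
    have hf' := (mem_cycles C').1 hf
    have hmem : ∀ k, C.proj (τ k) f ∈ C.cycles i (τ k) := fun k => by
      rw [mem_cycles]
      exact ⟨hprojmem _ _ _ hf'.1, by rw [diff_proj C hpres, ← hdiff, hf'.2, map_zero]⟩
    -- The index type may be infinite, but only finitely many degrees occur among the basis
    -- elements.
    let S : Finset I := (Finset.univ.image C.degree).preimage τ hτ.injOn
    refine ⟨∑ k ∈ S, DirectSum.lof ℤ I (fun k => C.Homology i (τ k)) k
      (Submodule.Quotient.mk ⟨_, hmem k⟩), ?_⟩
    have hΦ : ∀ k, Φ (DirectSum.lof ℤ I (fun k => C.Homology i (τ k)) k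
        (Submodule.Quotient.mk ⟨_, hmem k⟩)) =
        Submodule.Quotient.mk ⟨C.proj (τ k) f, (mem_cycles C').2
          ⟨hle _ k ((mem_cycles C).1 (hmem k)).1, hdiff ▸ ((mem_cycles C).1 (hmem k)).2⟩⟩ := by
      intro k
      simp only [Φ, DirectSum.toModule_lof]
      rfl
    rw [map_sum]
    simp only [hΦ]
    simp only [← Submodule.mkQ_apply]
    rw [← map_sum]
    refine congrArg _ (Subtype.ext ?_)
    rw [AddSubmonoidClass.coe_finsetSum]
    ext x
    rw [Finset.sum_apply]
    change ∑ k ∈ S, C.proj (τ k) f x = f x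
    by_cases hx : f x = 0
    · rw [hx]
      refine Finset.sum_eq_zero fun k _ => ?_
      by_cases h : C.degree x = τ k
      · rw [proj_apply_of_eq _ _ h, hx]
      · exact proj_apply_of_ne _ _ h
    · obtain ⟨k, hk⟩ := (hdeg x).1 (hf'.1 x hx).2
      rw [Finset.sum_eq_single k, proj_apply_of_eq _ _ hk]
      · intro l _ hl
        exact proj_apply_of_ne _ _ (fun h => hl (hτ (h.symm.trans hk)))
      · intro h
        exact absurd (Finset.mem_preimage.2 (Finset.mem_image.2 ⟨x, Finset.mem_univ _, hk⟩)) h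
  exact ⟨(LinearEquiv.ofBijective Φ ⟨hinj, hsurj⟩).symm.toAddEquiv⟩

theorem homology_subsingleton_of_degree_ne [Fintype G] (C : GradedComplex G Λ) (i : ℤ) (t : Λ)
    (h : ∀ x, C.degree x ≠ t) : Subsingleton (C.Homology i t) := by
  have : Subsingleton (C.cycles i t) := by
    refine ⟨fun f g => Subtype.ext (funext fun x => ?_)⟩
    have hz : ∀ f : C.cycles i t, (f : G → ℤ) x = 0 := fun f => by
      by_contra hx
      exact h x (((mem_cycles C).1 f.2).1 x hx).2
    rw [hz, hz]
  exact (Submodule.Quotient.mk_surjective _).subsingleton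

end GradedComplex

/-! ### Saddle moves -/

/-- Two partitions of a set `A` of arcs into circles differ by a saddle move that touches exactly
the circles through `a` and `b`. -/
structure IsSaddle {A : Type*} (r r' : Setoid A) (a b : A) : Prop where
  touched_iff : ∀ c, (r c a ∨ r c b) ↔ (r' c a ∨ r' c b)
  rel_iff : ∀ c d, ¬ r c a → ¬ r c b → (r c d ↔ r' c d)
  not_rel_iff : ¬ r a b ↔ r' a b

/-! ### Cycles of a permutation composed with a transposition -/

namespace Equiv.Perm

variable {A : Type*} (σ : Equiv.Perm A) {a b : A}

/-- If `n > 0` is minimal such that `σ ^ n` maps `a` to `a` or `b`, and it maps it to `a`, then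
`b` is on another cycle. -/
theorem not_sameCycle_of_first_return [Finite A] (hab : a ≠ b) {n : ℕ} (hn : 0 < n)
    (h : ∀ m, 0 < m → m < n → (σ ^ m) a ≠ a ∧ (σ ^ m) a ≠ b) (hna : (σ ^ n) a = a) :
    ¬ σ.SameCycle a b := by
  rintro hs
  obtain ⟨k, -, hk⟩ := hs.exists_pow_eq'
  have hmod : (σ ^ (k % n)) a = b := by
    rw [← hk]
    conv_rhs => rw [← Nat.mod_add_div k n, pow_add, mul_apply, pow_mul]
    rw [pow_apply_eq_self_of_apply_eq_self hna]
  rcases Nat.eq_zero_or_pos (k % n) with h0 | h0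
  · rw [h0] at hmod
    exact hab hmod
  · exact (h _ h0 (Nat.mod_lt _ hn)).2 hmod

variable [DecidableEq A]

/-- The transposition acts only on arrival at `a` or `b`, so the two orbits coincide until then. -/
theorem swap_mul_pow_apply {c : A} {n : ℕ}
    (h : ∀ m, 0 < m → m ≤ n → (σ ^ m) c ≠ a ∧ (σ ^ m) c ≠ b) :
    ((swap a b * σ) ^ n) c = (σ ^ n) c := by
  induction n with
  | zero => rfl
  | succ n ih =>
    have h1 := h (n + 1) (Nat.succ_pos _) le_rfl
    rw [pow_succ', mul_apply] at h1
    rw [pow_succ', mul_apply, ih fun m hm hmn => h m hm (hmn.trans n.le_succ), pow_succ', mul_apply,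
      mul_apply, swap_apply_of_ne_of_ne h1.1 h1.2]

theorem swap_mul_pow_apply_first {c : A} {n : ℕ} (hn : 0 < n)
    (h : ∀ m, 0 < m → m < n → (σ ^ m) c ≠ a ∧ (σ ^ m) c ≠ b) :
    ((swap a b * σ) ^ n) c = swap a b ((σ ^ n) c) := by
  obtain ⟨n, rfl⟩ := Nat.exists_eq_succ_of_ne_zero hn.ne'
  rw [pow_succ', mul_apply, swap_mul_pow_apply σ fun m hm hmn => h m hm (Nat.lt_succ_of_le hmn),
    pow_succ', mul_apply, mul_apply]

theorem sameCycle_of_sameCycle_swap_mul_of_not [Finite A] {c d : A} (ha : ¬ σ.SameCycle c a)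
    (hb : ¬ σ.SameCycle c b) (h : (swap a b * σ).SameCycle c d) : σ.SameCycle c d := by
  obtain ⟨n, -, rfl⟩ := h.exists_pow_eq'
  rw [swap_mul_pow_apply]
  · exact ⟨n, by simp⟩
  · intro m _ _
    exact ⟨fun h => ha ⟨m, by simpa using h⟩, fun h => hb ⟨m, by simpa using h⟩⟩

theorem sameCycle_swap_mul_of_sameCycle_of_not [Finite A] {c d : A} (ha : ¬ σ.SameCycle c a)
    (hb : ¬ σ.SameCycle c b) (h : σ.SameCycle c d) : (swap a b * σ).SameCycle c d := by
  obtain ⟨n, -, rfl⟩ := h.exists_pow_eq'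
  rw [← swap_mul_pow_apply σ (a := a) (b := b)]
  · exact ⟨n, by simp⟩
  · intro m _ _
    exact ⟨fun h => ha ⟨m, by simpa using h⟩, fun h => hb ⟨m, by simpa using h⟩⟩

theorem sameCycle_swap_mul_touched [Finite A] {c : A} (h : σ.SameCycle c a ∨ σ.SameCycle c b) :
    (swap a b * σ).SameCycle c a ∨ (swap a b * σ).SameCycle c b := by
  classical
  -- Up to the first arrival at `a` or `b` the orbits agree; there the new one arrives at the other
  -- of the two points.
  have hex : ∃ n, 0 < n ∧ ((σ ^ n) c = a ∨ (σ ^ n) c = b) := by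
    rcases h with h | h <;> obtain ⟨n, hn, -, h⟩ := h.exists_pow_eq''
    · exact ⟨n, hn, Or.inl h⟩
    · exact ⟨n, hn, Or.inr h⟩
  obtain ⟨hn, h⟩ := Nat.find_spec hex
  have key := swap_mul_pow_apply_first σ (a := a) (b := b) (c := c) hn fun m hm hmn => by
    have := Nat.find_min hex hmn
    push Not at this
    exact this hm
  rcases h with h | h <;> rw [h] at key
  · exact Or.inr ⟨_, by rw [zpow_natCast, key, swap_apply_left]⟩
  · exact Or.inl ⟨_, by rw [zpow_natCast, key, swap_apply_right]⟩

/-- Consider the first return of `a` to the set of `a` and `b`. The transposition exchanges the two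
possible outcomes, and the outcome decides whether `b` is on the cycle of `a`. -/
theorem not_sameCycle_iff_sameCycle_swap_mul [Finite A] (hab : a ≠ b) :
    ¬ σ.SameCycle a b ↔ (swap a b * σ).SameCycle a b := by
  classical
  have hex : ∃ n, 0 < n ∧ ((σ ^ n) a = a ∨ (σ ^ n) a = b) := by
    obtain ⟨n, hn, -, h⟩ := (SameCycle.refl σ a).exists_pow_eq''
    exact ⟨n, hn, Or.inl h⟩
  obtain ⟨hn, h⟩ := Nat.find_spec hex
  have hmin : ∀ m, 0 < m → m < Nat.find hex → (σ ^ m) a ≠ a ∧ (σ ^ m) a ≠ b := fun m hm hmn => by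
    have := Nat.find_min hex hmn
    push Not at this
    exact this hm
  have key := swap_mul_pow_apply_first σ hn hmin
  have hmin' : ∀ m, 0 < m → m < Nat.find hex →
      ((swap a b * σ) ^ m) a ≠ a ∧ ((swap a b * σ) ^ m) a ≠ b := fun m hm hmn => by
    rw [swap_mul_pow_apply σ fun k hk hkm => hmin k hk (hkm.trans_lt hmn)]
    exact hmin m hm hmn
  rcases h with h | h
  · rw [h, swap_apply_left] at key
    exact iff_of_true (not_sameCycle_of_first_return σ hab hn hmin h)
      ⟨_, by rw [zpow_natCast, key]⟩
  · rw [h, swap_apply_right] at key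
    refine iff_of_false (not_not.2 ⟨_, by rw [zpow_natCast, h]⟩) ?_
    exact not_sameCycle_of_first_return _ hab hn hmin' key

/-- Composing a permutation with a transposition is a saddle move on its cycles. -/
theorem isSaddle_swap_mul [Finite A] (hab : a ≠ b) :
    IsSaddle (SameCycle.setoid σ) (SameCycle.setoid (swap a b * σ)) a b where
  touched_iff c := by
    refine ⟨sameCycle_swap_mul_touched σ, fun h => ?_⟩
    have := sameCycle_swap_mul_touched _ h
    rwa [swap_mul_self_mul] at this
  rel_iff c d ha hb := ⟨sameCycle_swap_mul_of_sameCycle_of_not σ ha hb,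
    sameCycle_of_sameCycle_swap_mul_of_not σ ha hb⟩
  not_rel_iff := not_sameCycle_iff_sameCycle_swap_mul σ hab

end Equiv.Perm

/-! ### Numbers of circles and degrees under a saddle move -/

namespace IsSaddle

variable {A : Type*} {r r' : Setoid A} {a b : A}

theorem symm (h : IsSaddle r r' a b) : IsSaddle r' r a b where
  touched_iff c := (h.touched_iff c).symm
  rel_iff c d ha hb := by
    have := h.touched_iff c
    rw [h.rel_iff c d] <;> tauto
  not_rel_iff := by rw [← h.not_rel_iff, not_not]

open Classical in
/-- A sum over the circles before a saddle move and a sum over the circles after it differ only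
in the contributions of the touched circles. -/
theorem sum_touched_compl [Fintype (Quotient r)] [Fintype (Quotient r')] (h : IsSaddle r r' a b)
    (f : Quotient r → ℤ) (f' : Quotient r' → ℤ)
    (hf : ∀ c, ¬ r c a → ¬ r c b → f (Quotient.mk r c) = f' (Quotient.mk r' c)) :
    (∑ q, f q) - (∑ q ∈ {Quotient.mk r a, Quotient.mk r b}, f q) =
      (∑ q, f' q) - (∑ q ∈ {Quotient.mk r' a, Quotient.mk r' b}, f' q) := by
  have e1 := Finset.sum_compl_add_sum {Quotient.mk r a, Quotient.mk r b} f
  have e2 := Finset.sum_compl_add_sum {Quotient.mk r' a, Quotient.mk r' b} f'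
  have hmem : ∀ c, Quotient.mk r c ∈ ({Quotient.mk r a, Quotient.mk r b}ᶜ : Finset _) ↔
      ¬ r c a ∧ ¬ r c b := fun c => by
    simp only [Finset.mem_compl, Finset.mem_insert, Finset.mem_singleton, not_or]
    exact and_congr (not_congr Quotient.eq) (not_congr Quotient.eq)
  have hmem' : ∀ c, Quotient.mk r' c ∈ ({Quotient.mk r' a, Quotient.mk r' b}ᶜ : Finset _) ↔
      ¬ r c a ∧ ¬ r c b := fun c => by
    rw [← not_or, h.touched_iff, not_or]
    simp only [Finset.mem_compl, Finset.mem_insert, Finset.mem_singleton, not_or]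
    exact and_congr (not_congr Quotient.eq) (not_congr Quotient.eq)
  have e3 : ∑ q ∈ ({Quotient.mk r a, Quotient.mk r b}ᶜ : Finset _), f q =
      ∑ q ∈ ({Quotient.mk r' a, Quotient.mk r' b}ᶜ : Finset _), f' q := by
    -- An untouched circle is the same class of arcs before and after the move, so any
    -- representative identifies the two.
    refine Finset.sum_bij (fun q _ => Quotient.mk r' q.out) ?_ ?_ ?_ ?_
    · intro q hq
      rw [← q.out_eq, hmem] at hq
      exact (hmem' _).2 hq
    · intro q hq p hp hqp
      rw [← q.out_eq, hmem] at hq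
      rw [← q.out_eq, ← p.out_eq]
      exact Quotient.sound ((h.rel_iff _ _ hq.1 hq.2).2 (Quotient.exact hqp))
    · intro p hp
      rw [← p.out_eq, hmem'] at hp
      refine ⟨Quotient.mk r p.out, (hmem _).2 hp, ?_⟩
      conv_rhs => rw [← p.out_eq]
      refine Quotient.sound (r'.symm ((h.rel_iff _ _ hp.1 hp.2).1 (r.symm ?_)))
      exact Quotient.exact (Quotient.out_eq _)
    · intro q hq
      rw [← q.out_eq, hmem] at hq
      conv_lhs => rw [← q.out_eq]
      exact hf _ hq.1 hq.2
  linarith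

/-- A merging saddle move decreases the number of circles by one. -/
theorem card_add_one [Finite A] (h : IsSaddle r r' a b) (hab : ¬ r a b) :
    Nat.card (Quotient r) = Nat.card (Quotient r') + 1 := by
  classical
  have := Fintype.ofFinite (Quotient r)
  have := Fintype.ofFinite (Quotient r')
  -- Summing the constant `1` counts circles: two touched ones before the merge, one after it.
  have key := h.sum_touched_compl (fun _ => 1) (fun _ => 1) fun _ _ _ => rfl
  have h1 : Quotient.mk r a ≠ Quotient.mk r b := fun e => hab (Quotient.exact e)
  have h2 : Quotient.mk r' a = Quotient.mk r' b := Quotient.sound (h.not_rel_iff.1 hab)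
  rw [Finset.sum_pair h1, h2, Finset.pair_eq_singleton, Finset.sum_singleton] at key
  simp only [Finset.sum_const, Finset.card_univ, ← Nat.card_eq_fintype_card] at key
  simp only [nsmul_eq_mul, mul_one] at key
  linarith

theorem card_le_card_add_one [Finite A] (h : IsSaddle r r' a b) :
    Nat.card (Quotient r') ≤ Nat.card (Quotient r) + 1 := by
  by_cases hab : r a b
  · exact (h.symm.card_add_one fun h' => h.not_rel_iff.2 h' hab).le
  · have := h.card_add_one hab
    omega

/-- The maps of a saddle move lower the degree by one. -/
theorem degree_eq [Finite A] (h : IsSaddle r r' a b) {l : Quotient r → Bool}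
    {l' : Quotient r' → Bool} (hne : saddleCoeff r r' a b l l' ≠ 0) :
    ∑ᶠ q, pmDeg (l q) = (∑ᶠ q, pmDeg (l' q)) + 1 := by
  classical
  have := Fintype.ofFinite (Quotient r)
  have := Fintype.ofFinite (Quotient r')
  rw [finsum_eq_sum_of_fintype, finsum_eq_sum_of_fintype]
  unfold saddleCoeff at hne
  split_ifs at hne with hc hab hab'
  · exact absurd rfl hne
  · have key := h.sum_touched_compl (fun q => pmDeg (l q)) (fun q => pmDeg (l' q))
      fun c h1 h2 => by rw [hc c h1 h2]
    have h1 : Quotient.mk r a = Quotient.mk r b := Quotient.sound hab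
    have h2 : Quotient.mk r' a ≠ Quotient.mk r' b := fun e => hab' (Quotient.exact e)
    rw [Finset.sum_pair h2, ← h1, Finset.pair_eq_singleton, Finset.sum_singleton] at key
    have : pmDeg (l (Quotient.mk r a)) =
        pmDeg (l' (Quotient.mk r' a)) + pmDeg (l' (Quotient.mk r' b)) + 1 := by
      revert hne
      cases l (Quotient.mk r a) <;> cases l' (Quotient.mk r' a) <;>
        cases l' (Quotient.mk r' b) <;> simp [comulCoeff, pmDeg]
    linarith
  · have key := h.sum_touched_compl (fun q => pmDeg (l q)) (fun q => pmDeg (l' q))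
      fun c h1 h2 => by rw [hc c h1 h2]
    have h1 : Quotient.mk r a ≠ Quotient.mk r b := fun e => hab (Quotient.exact e)
    have h2 : Quotient.mk r' a = Quotient.mk r' b := Quotient.sound (h.not_rel_iff.1 hab)
    rw [Finset.sum_pair h1, ← h2, Finset.pair_eq_singleton, Finset.sum_singleton] at key
    have : pmDeg (l (Quotient.mk r a)) + pmDeg (l (Quotient.mk r b)) =
        pmDeg (l' (Quotient.mk r' a)) + 1 := by
      revert hne
      cases l (Quotient.mk r a) <;> cases l (Quotient.mk r b) <;>
        cases l' (Quotient.mk r' a) <;> simp [mulCoeff, pmDeg]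
    linarith
  · exact absurd rfl hne

end IsSaddle

/-- Cocommutativity makes it irrelevant which of the two new circles is named first. -/
theorem comulCoeff_comm (x y z : Bool) : comulCoeff x y z = comulCoeff x z y := by
  cases x <;> cases y <;> cases z <;> rfl

open Classical in
/-- Saddle coefficients are invariant under a bijection between the circles that comes from a map
of arcs, even if it exchanges the two new circles. -/
theorem saddleCoeff_comap {A B : Type*} {r r' : Setoid A} {s s' : Setoid B} (φ : A → B)
    (e : Quotient r ≃ Quotient s) (e' : Quotient r' ≃ Quotient s')
    (he : ∀ c, e (Quotient.mk r c) = Quotient.mk s (φ c))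
    (he' : ∀ c, e' (Quotient.mk r' c) = Quotient.mk s' (φ c))
    {a b : A} {a' b' : B} (ha : s (φ a) a') (hb : s (φ b) b')
    (hab : (s' (φ a) a' ∧ s' (φ b) b') ∨ (s' (φ a) b' ∧ s' (φ b) a'))
    (hmerge : ¬ r a b → r' a b)
    (hsat : ∀ d, ∃ c, s d (φ c) ∧ s' d (φ c))
    (l : Quotient s → Bool) (l' : Quotient s' → Bool) :
    saddleCoeff r r' a b (l ∘ e) (l' ∘ e') = saddleCoeff s s' a' b' l l' := by
  have hr : ∀ c d, r c d ↔ s (φ c) (φ d) := fun c d => by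
    have := e.injective.eq_iff (a := Quotient.mk r c) (b := Quotient.mk r d)
    rw [he, he] at this
    exact (Quotient.eq.symm.trans this.symm).trans Quotient.eq
  have hr' : ∀ c d, r' c d ↔ s' (φ c) (φ d) := fun c d => by
    have := e'.injective.eq_iff (a := Quotient.mk r' c) (b := Quotient.mk r' d)
    rw [he', he'] at this
    exact (Quotient.eq.symm.trans this.symm).trans Quotient.eq
  have qa : Quotient.mk s (φ a) = Quotient.mk s a' := Quotient.sound ha
  have qb : Quotient.mk s (φ b) = Quotient.mk s b' := Quotient.sound hb
  have ta : ∀ d, s d (φ a) ↔ s d a' := fun d =>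
    ⟨fun h => s.trans h ha, fun h => s.trans h (s.symm ha)⟩
  have tb : ∀ d, s d (φ b) ↔ s d b' := fun d =>
    ⟨fun h => s.trans h hb, fun h => s.trans h (s.symm hb)⟩
  have hcond : (∀ c, ¬ r c a → ¬ r c b →
        (l ∘ e) (Quotient.mk r c) = (l' ∘ e') (Quotient.mk r' c)) ↔
      ∀ d, ¬ s d a' → ¬ s d b' → l (Quotient.mk s d) = l' (Quotient.mk s' d) := by
    constructor
    · intro h d h1 h2
      obtain ⟨c, hc, hc'⟩ := hsat d
      have := h c (fun h' => h1 ((ta d).1 (s.trans hc ((hr _ _).1 h'))))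
        (fun h' => h2 ((tb d).1 (s.trans hc ((hr _ _).1 h'))))
      simp only [Function.comp, he, he'] at this
      rwa [Quotient.sound hc, Quotient.sound hc']
    · intro h c h1 h2
      simp only [Function.comp, he, he']
      exact h _ (fun h' => h1 ((hr _ _).2 ((ta _).2 h'))) (fun h' => h2 ((hr _ _).2 ((tb _).2 h')))
  have hrab : r a b ↔ s a' b' := by
    rw [hr, tb]
    exact ⟨fun h => s.trans (s.symm ha) h, fun h => s.trans ha h⟩
  unfold saddleCoeff
  by_cases h : r a b
  · refine if_congr hcond ?_ rfl
    rw [if_pos h, if_pos (hrab.1 h)]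
    rcases hab with ⟨h1, h2⟩ | ⟨h1, h2⟩
    · refine if_congr ?_ rfl ?_
      · rw [hr']
        exact ⟨fun h => s'.trans (s'.symm h1) (s'.trans h h2),
          fun h => s'.trans h1 (s'.trans h (s'.symm h2))⟩
      · simp only [Function.comp, he, he', qa, Quotient.sound h1, Quotient.sound h2]
    · refine if_congr ?_ rfl ?_
      · rw [hr']
        exact ⟨fun h => s'.symm (s'.trans (s'.symm h1) (s'.trans h h2)),
          fun h => s'.trans h1 (s'.trans (s'.symm h) (s'.symm h2))⟩
      · simp only [Function.comp, he, he', qa, Quotient.sound h1, Quotient.sound h2]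
        exact comulCoeff_comm _ _ _
  · refine if_congr hcond ?_ rfl
    rw [if_neg h, if_neg (hrab.not.1 h)]
    -- If the marked points are exchanged after the move, the merge has put both on one circle
    -- anyway.
    have ha' : s' (φ a) a' := by
      rcases hab with ⟨h1, -⟩ | ⟨-, h2⟩
      · exact h1
      · exact s'.trans ((hr' _ _).1 (hmerge h)) h2
    simp only [Function.comp, he, he', qa, qb, Quotient.sound ha']

/-! ### Cancellation for finitely generated abelian groups -/

theorem sum_min_succ {ι : Type*} [Fintype ι] (w : ι → ℕ) (m : ℕ) :
    ∑ i, min (w i) (m + 1) =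
      ∑ i, min (w i) m + (Finset.univ.filter fun i => m < w i).card := by
  rw [Finset.card_filter, ← Finset.sum_add_distrib]
  refine Finset.sum_congr rfl fun i _ => ?_
  split_ifs <;> omega

/-- Multiplicities can be recovered from the sums of truncations. -/
theorem card_lt_eq_of_sum_min_eq {ι ι' : Type*} [Fintype ι] [Fintype ι'] {r r' : ℕ}
    {w : ι → ℕ} {w' : ι' → ℕ}
    (h : ∀ m, m * r + ∑ i, min (w i) m = m * r' + ∑ i, min (w' i) m) :
    r = r' ∧ ∀ m, (Finset.univ.filter fun i => m < w i).card =
      (Finset.univ.filter fun i => m < w' i).card := by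
  -- Taking differences of consecutive `m` turns truncated sums into counts of large weights.
  have hdiff : ∀ m, r + (Finset.univ.filter fun i => m < w i).card =
      r' + (Finset.univ.filter fun i => m < w' i).card := by
    intro m
    have h1 := h m
    have h2 := h (m + 1)
    rw [sum_min_succ, sum_min_succ, add_mul, add_mul] at h2
    omega
  have hr : r = r' := by
    -- No single weight exceeds the sum of all of them, so both counts vanish here and only the
    -- ranks remain.
    have := hdiff (∑ i, w i + ∑ i, w' i)
    rw [Finset.filter_false_of_mem, Finset.filter_false_of_mem] at this
    · simpa using this
    · intro i _
      have := Finset.single_le_sum (f := w') (fun _ _ => Nat.zero_le _) (Finset.mem_univ i)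
      omega
    · intro i _
      have := Finset.single_le_sum (f := w) (fun _ _ => Nat.zero_le _) (Finset.mem_univ i)
      omega
  refine ⟨hr, fun m => ?_⟩
  have := hdiff m
  omega

theorem card_eq_add_card_succ_lt {ι : Type*} [Fintype ι] (w : ι → ℕ) (m : ℕ) :
    (Finset.univ.filter fun i => m < w i).card =
      (Finset.univ.filter fun i => w i = m + 1).card +
        (Finset.univ.filter fun i => m + 1 < w i).card := by
  classical
  rw [← Finset.card_union_of_disjoint, ← Finset.filter_or]
  · refine congrArg _ (Finset.filter_congr fun i _ => ?_)
    omega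
  · rw [Finset.disjoint_filter]
    intro i _ h
    omega

theorem factorization_eq_succ_iff {q p k : ℕ} (hp : p.Prime)
    (hq : ∃ p' e, p'.Prime ∧ q = p' ^ e) : q.factorization p = k + 1 ↔ q = p ^ (k + 1) := by
  constructor
  · obtain ⟨p', e, hp', rfl⟩ := hq
    intro h
    rw [hp'.factorization_pow] at h
    by_cases hpp : p' = p
    · subst hpp
      rw [Finsupp.single_eq_same] at h
      rw [h]
    · rw [Finsupp.single_eq_of_ne (Ne.symm hpp)] at h
      omega
  · rintro rfl
    rw [hp.factorization_pow, Finsupp.single_eq_same]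

/-- With `n = p ^ m`, the `p`-adic valuation of the number of homomorphisms to `ZMod n` becomes a
sum of truncated exponents, the form needed by `card_lt_eq_of_sum_min_eq`. -/
theorem factorization_pow_mul_prod_gcd {p : ℕ} (hp : p.Prime) (m : ℕ) {ι : Type*} [Fintype ι]
    (r : ℕ) (q : ι → ℕ) (hq : ∀ i, q i ≠ 0) :
    ((p ^ m) ^ r * ∏ i, (p ^ m).gcd (q i)).factorization p =
      m * r + ∑ i, min ((q i).factorization p) m := by
  have h0 : ∀ i, (p ^ m).gcd (q i) ≠ 0 := fun i => Nat.gcd_ne_zero_right (hq i)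
  rw [Nat.factorization_mul (pow_ne_zero _ (pow_ne_zero _ hp.ne_zero))
    (Finset.prod_ne_zero_iff.2 fun i _ => h0 i), Finsupp.add_apply,
    Nat.factorization_prod fun i _ => h0 i, Finsupp.finsetSum_apply, ← pow_mul,
    hp.factorization_pow, Finsupp.single_eq_same]
  refine congrArg _ (Finset.sum_congr rfl fun i _ => ?_)
  rw [Nat.factorization_gcd (pow_ne_zero _ hp.ne_zero) (hq i), Finsupp.inf_apply,
    hp.factorization_pow, Finsupp.single_eq_same, inf_comm]

/-- The rank and the multiplicities of the prime powers are determined by the numbers of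
homomorphisms to finite cyclic groups. -/
theorem multiplicities_eq_of_prod_gcd_eq {ι ι' : Type*} [Fintype ι] [Fintype ι'] {r r' : ℕ}
    {q : ι → ℕ} {q' : ι' → ℕ} (hq : ∀ i, ∃ p e, p.Prime ∧ q i = p ^ e)
    (hq' : ∀ i, ∃ p e, p.Prime ∧ q' i = p ^ e)
    (h : ∀ n, 0 < n → n ^ r * ∏ i, n.gcd (q i) = n ^ r' * ∏ i, n.gcd (q' i)) :
    r = r' ∧ ∀ k, k ≠ 1 → (Finset.univ.filter fun i => q i = k).card =
      (Finset.univ.filter fun i => q' i = k).card := by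
  have hne : ∀ {q : ℕ}, (∃ p e, p.Prime ∧ q = p ^ e) → q ≠ 0 := by
    rintro _ ⟨p, e, hp, rfl⟩
    exact (pow_pos hp.pos _).ne'
  have key : ∀ {p : ℕ} (_ : p.Prime), _ := fun {p} hp =>
    card_lt_eq_of_sum_min_eq (r := r) (r' := r') (w := fun i => (q i).factorization p)
      (w' := fun i => (q' i).factorization p) fun m => by
        rw [← factorization_pow_mul_prod_gcd hp m r q fun i => hne (hq i),
          h _ (pow_pos hp.pos _), factorization_pow_mul_prod_gcd hp m r' q' fun i => hne (hq' i)]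
  refine ⟨(key Nat.prime_two).1, fun k hk => ?_⟩
  by_cases hpk : ∃ p e, p.Prime ∧ k = p ^ e
  · obtain ⟨p, e, hp, rfl⟩ := hpk
    obtain ⟨m, rfl⟩ : ∃ m, e = m + 1 := Nat.exists_eq_succ_of_ne_zero (by
      rintro rfl
      exact hk (pow_zero _))
    have h1 := (key hp).2 m
    rw [card_eq_add_card_succ_lt, card_eq_add_card_succ_lt (fun i => (q' i).factorization p),
      (key hp).2 (m + 1), add_left_inj] at h1
    simpa only [factorization_eq_succ_iff hp (hq _), factorization_eq_succ_iff hp (hq' _)] using h1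
  · rw [Finset.filter_false_of_mem, Finset.filter_false_of_mem]
    · rfl
    · rintro i - rfl
      exact hpk (hq' i)
    · rintro i - rfl
      exact hpk (hq i)

/-- Homomorphisms from a product are pairs of homomorphisms. -/
def addMonoidHomProdEquiv (A B C : Type*) [AddCommGroup A] [AddCommGroup B] [AddCommGroup C] :
    (A × B →+ C) ≃ (A →+ C) × (B →+ C) where
  toFun f := (f.comp (AddMonoidHom.inl A B), f.comp (AddMonoidHom.inr A B))
  invFun p := p.1.coprod p.2
  left_inv f := AddMonoidHom.coprod_unique f
  right_inv p := by simp

/-- A homomorphism from `ZMod m` is an element killed by `m`, and multiplication by `m` on a cyclic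
group of order `n` has a kernel of order `gcd n m`. -/
theorem card_zmod_hom_zmod (m n : ℕ) [NeZero n] :
    Nat.card (ZMod m →+ ZMod n) = n.gcd m := by
  rw [← Nat.card_congr (ZMod.lift m)]
  have h := IsAddCyclic.card_nsmulAddMonoidHom_ker (ZMod n) m
  rw [Nat.card_zmod] at h
  rw [← h]
  refine Nat.card_congr ((zmultiplesHom (ZMod n)).symm.subtypeEquiv fun f => ?_)
  rw [AddMonoidHom.mem_ker, nsmulAddMonoidHom_apply]
  have : f (m : ℤ) = m • f 1 := by
    rw [← map_nsmul, nsmul_one]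
  rw [this]
  rfl

theorem card_hom_zmod (r : ℕ) {ι : Type*} [Fintype ι] [DecidableEq ι] (q : ι → ℕ) (n : ℕ)
    [NeZero n] :
    Nat.card ((Fin r →₀ ℤ) × (DirectSum ι fun i => ZMod (q i)) →+ ZMod n) =
      n ^ r * ∏ i, n.gcd (q i) := by
  rw [Nat.card_congr (addMonoidHomProdEquiv _ _ _), Nat.card_prod,
    ← Nat.card_congr (Finsupp.liftAddHom (α := Fin r) (M := ℤ) (N := ZMod n)).toEquiv,
    show Nat.card ((DirectSum ι fun i => ZMod (q i)) →+ ZMod n) = _ from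
      (Nat.card_congr (DFinsupp.liftAddHom (β := fun i => ZMod (q i)) (γ := ZMod n)).toEquiv).symm,
    Nat.card_pi, Nat.card_pi]
  congr 1
  · rw [Finset.prod_const, ← Nat.card_congr (zmultiplesHom (ZMod n)), Nat.card_zmod,
      Finset.card_univ, Fintype.card_fin]
  · exact Finset.prod_congr rfl fun i _ => card_zmod_hom_zmod _ _

/-- A product of groups that depend on a parameter, sorted by the value of the parameter. -/
theorem piEquivPiFiber {ι K : Type*} (q : ι → K) (M : K → Type*) [∀ k, AddCommGroup (M k)] :
    Nonempty ((∀ i, M (q i)) ≃+ ∀ k, {i // q i = k} → M k) := by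
  let φ : (∀ k, {i // q i = k} → M k) →+ ∀ i, M (q i) :=
    { toFun := fun g i => g (q i) ⟨i, rfl⟩
      map_zero' := rfl
      map_add' := fun _ _ => rfl }
  refine ⟨(AddEquiv.ofBijective φ ⟨fun f g h => ?_, fun f => ?_⟩).symm⟩
  · funext k ⟨i, hi⟩
    subst hi
    exact congrFun h i
  · exact ⟨fun k x => x.2 ▸ f x.1, rfl⟩

theorem nonempty_addEquiv_of_subsingleton (A B : Type*) [AddCommGroup A] [AddCommGroup B]
    [Subsingleton A] [Subsingleton B] : Nonempty (A ≃+ B) :=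
  ⟨{ toFun := 0
     invFun := 0
     left_inv := fun _ => Subsingleton.elim _ _
     right_inv := fun _ => Subsingleton.elim _ _
     map_add' := fun _ _ => Subsingleton.elim _ _ }⟩

/-- A finitely generated abelian group is determined by the numbers of its homomorphisms to finite
cyclic groups. -/
theorem nonempty_addEquiv_of_card_hom_eq (A B : Type*) [AddCommGroup A] [AddCommGroup B]
    [AddGroup.FG A] [AddGroup.FG B]
    (h : ∀ n, 0 < n → Nat.card (A →+ ZMod n) = Nat.card (B →+ ZMod n)) : Nonempty (A ≃+ B) := by
  classical
  obtain ⟨r, ι, _, p, hp, e, ⟨f⟩⟩ := AddCommGroup.equiv_free_prod_directSum_zmod A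
  obtain ⟨r', ι', _, p', hp', e', ⟨f'⟩⟩ := AddCommGroup.equiv_free_prod_directSum_zmod B
  obtain ⟨hr, hm⟩ := multiplicities_eq_of_prod_gcd_eq (r := r) (r' := r')
    (q := fun i => p i ^ e i) (q' := fun i => p' i ^ e' i)
    (fun i => ⟨_, _, hp i, rfl⟩) (fun i => ⟨_, _, hp' i, rfl⟩) fun n hn => by
      have : NeZero n := ⟨hn.ne'⟩
      rw [← card_hom_zmod, ← card_hom_zmod,
        ← Nat.card_congr f.addMonoidHomCongrLeftEquiv,
        ← Nat.card_congr f'.addMonoidHomCongrLeftEquiv, h n hn]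
  subst hr
  have hfib : ∀ k, Nonempty (({i // p i ^ e i = k} → ZMod k) ≃+ ({i // p' i ^ e' i = k} → ZMod k)) := by
    intro k
    -- Exponents may be zero, so trivial summands can occur. Their number is not determined, but it
    -- does not matter.
    by_cases hk : k = 1
    · subst hk
      exact nonempty_addEquiv_of_subsingleton _ _
    · have := hm k hk
      rw [← Fintype.card_subtype, ← Fintype.card_subtype] at this
      exact ⟨AddEquiv.arrowCongr (Fintype.equivOfCardEq this) (AddEquiv.refl _)⟩
  obtain ⟨g⟩ := piEquivPiFiber (fun i => p i ^ e i) ZMod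
  obtain ⟨g'⟩ := piEquivPiFiber (fun i => p' i ^ e' i) ZMod
  let F := fun k => (hfib k).some
  exact ⟨f.trans <| (AddEquiv.prodCongr (AddEquiv.refl _)
    ((DirectSum.addEquivProd _).trans <| g.trans <| (AddEquiv.piCongrRight F).trans <|
      g'.symm.trans (DirectSum.addEquivProd _).symm)).trans f'.symm⟩

theorem card_hom_zmod_ne_zero (A : Type*) [AddCommGroup A] [AddGroup.FG A] (n : ℕ) (hn : 0 < n) :
    Nat.card (A →+ ZMod n) ≠ 0 := by
  classical
  have : NeZero n := ⟨hn.ne'⟩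
  obtain ⟨r, ι, _, p, hp, e, ⟨f⟩⟩ := AddCommGroup.equiv_free_prod_directSum_zmod A
  rw [Nat.card_congr f.addMonoidHomCongrLeftEquiv, card_hom_zmod]
  exact mul_ne_zero (pow_ne_zero _ hn.ne') (Finset.prod_ne_zero_iff.2 fun i _ =>
    Nat.gcd_ne_zero_left hn.ne')

/-- Finitely generated abelian groups can be cancelled from products. -/
theorem nonempty_addEquiv_of_prod {A A' B B' : Type*} [AddCommGroup A] [AddCommGroup A']
    [AddCommGroup B] [AddCommGroup B'] [AddGroup.FG A] [AddGroup.FG A'] [AddGroup.FG B]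
    [AddGroup.FG B'] (f : A ≃+ A') (g : (A × B) ≃+ (A' × B')) : Nonempty (B ≃+ B') := by
  refine nonempty_addEquiv_of_card_hom_eq _ _ fun n hn => ?_
  have h := Nat.card_congr (g.addMonoidHomCongrLeftEquiv (N := ZMod n))
  rw [Nat.card_congr (addMonoidHomProdEquiv _ _ _), Nat.card_congr (addMonoidHomProdEquiv _ _ _),
    Nat.card_prod, Nat.card_prod, Nat.card_congr (f.addMonoidHomCongrLeftEquiv (N := ZMod n))] at h
  exact Nat.eq_of_mul_eq_mul_left (Nat.pos_of_ne_zero (card_hom_zmod_ne_zero _ _ hn)) h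

theorem addGroup_fg_pi {I : Type*} [Finite I] (M : I → Type*) [∀ i, AddCommGroup (M i)]
    [∀ i, AddGroup.FG (M i)] : AddGroup.FG (∀ i, M i) := by
  have : ∀ i, Module.Finite ℤ (M i) := fun i => Module.Finite.iff_addGroup_fg.2 inferInstance
  exact Module.Finite.iff_addGroup_fg.1 inferInstance

/-- Splitting one factor off a product of groups. -/
def addEquivPiSplitAt {I : Type*} [DecidableEq I] (a : I) (M : I → Type*)
    [∀ i, AddCommGroup (M i)] : (∀ i, M i) ≃+ M a × ∀ i : {i // i ≠ a}, M i :=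
  { Equiv.piSplitAt a M with map_add' := fun _ _ => rfl }

/-- A sequence of finitely generated abelian groups that vanishes in large degrees is determined
by the sums of its shifts by the weights `wt a`, if the largest weight is attained only once. -/
theorem nonempty_addEquiv_of_pi_shift {I : Type*} [Finite I] (wt : I → ℤ) (a₀ : I)
    (hwt : ∀ a, a ≠ a₀ → wt a < wt a₀) (K K' : ℤ → Type*) [∀ m, AddCommGroup (K m)]
    [∀ m, AddCommGroup (K' m)] [∀ m, AddGroup.FG (K m)] [∀ m, AddGroup.FG (K' m)]
    (N : ℤ) (hK : ∀ m, N < m → Subsingleton (K m)) (hK' : ∀ m, N < m → Subsingleton (K' m))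
    (h : ∀ j, Nonempty ((∀ a, K (j - wt a)) ≃+ ∀ a, K' (j - wt a))) (m : ℤ) :
    Nonempty (K m ≃+ K' m) := by
  classical
  have := Fintype.ofFinite I
  have main : ∀ d : ℕ, ∀ m, N < m + d → Nonempty (K m ≃+ K' m) := by
    intro d
    induction d with
    | zero =>
      intro m hm
      have := hK m (by simpa using hm)
      have := hK' m (by simpa using hm)
      exact nonempty_addEquiv_of_subsingleton _ _
    | succ d ih =>
      intro m hm
      -- In this degree the factor of `a₀` is `K m`. All other factors have larger degree and are
      -- known by induction, so they cancel.
      obtain ⟨e⟩ := h (m + wt a₀)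
      have hrest : ∀ a : {a // a ≠ a₀},
          Nonempty (K (m + wt a₀ - wt a) ≃+ K' (m + wt a₀ - wt a)) := fun a => by
        have := hwt a a.2
        push_cast at hm
        exact ih _ (by linarith)
      let F := fun a => (hrest a).some
      have := addGroup_fg_pi fun a : {a // a ≠ a₀} => K (m + wt a₀ - wt a)
      have := addGroup_fg_pi fun a : {a // a ≠ a₀} => K' (m + wt a₀ - wt a)
      have key := nonempty_addEquiv_of_prod (AddEquiv.piCongrRight F)
        (AddEquiv.prodComm.trans <| (addEquivPiSplitAt a₀ fun a => K (m + wt a₀ - wt a)).symm.trans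
          <| e.trans <| (addEquivPiSplitAt a₀ fun a => K' (m + wt a₀ - wt a)).trans
            AddEquiv.prodComm)
      rwa [add_sub_cancel_right] at key
  exact main (N - m + 1).toNat m (by have := Int.self_le_toNat (N - m + 1); linarith)

/-! ### Adding an edge to a spanning subfatgraph -/

namespace Fatgraph

variable {V E : Type*} (F : Fatgraph V E)

/-- The new bridge affects the walk only on arrival at one of its own half-edges, where it sends the
walk to the other one. -/
theorem walk_insert [DecidableEq E] [DecidableEq ((E × Bool) ⊕ F.Isolated)] {H : Finset E}
    {e : E} (he : e ∉ H) :
    F.walk (insert e H) =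
      Equiv.swap (Sum.inl (e, false)) (Sum.inl (e, true)) * F.walk H := by
  ext1 x
  rcases x with d | w
  · simp only [walk, Equiv.Perm.mul_apply, Equiv.sumCongr_apply, Sum.map_inl, Equiv.trans_apply,
      Function.Involutive.coe_toPerm, cross]
    generalize F.rot d = c
    obtain ⟨f, b⟩ := c
    by_cases hf : f = e
    · subst hf
      cases b <;> simp [he]
    · by_cases hfH : f ∈ H <;>
      simp [hf, hfH, Equiv.swap_apply_of_ne_of_ne]
  · simp [walk, Equiv.swap_apply_of_ne_of_ne]

theorem isSaddle_insert [Finite V] [Finite E] [DecidableEq E] {H : Finset E} {e : E}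
    (he : e ∉ H) :
    IsSaddle (F.boundarySetoid H) (F.boundarySetoid (insert e H))
      (Sum.inl (e, false)) (Sum.inl (e, true)) := by
  classical
  rw [boundarySetoid, boundarySetoid, walk_insert F he]
  exact Equiv.Perm.isSaddle_swap_mul _ (by simp)

theorem isSaddle_erase [Finite V] [Finite E] [DecidableEq E] {H : Finset E} {e : E}
    (he : e ∈ H) :
    IsSaddle (F.boundarySetoid H) (F.boundarySetoid (H.erase e))
      (Sum.inl (e, false)) (Sum.inl (e, true)) := by
  have := (F.isSaddle_insert (Finset.notMem_erase e H)).symm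
  rwa [Finset.insert_erase he] at this

/-! #### Connected components and genus -/

/-- The component of the spanning subfatgraph `H` on which an arc lies. -/
def arcComponent (H : Finset E) : (E × Bool) ⊕ F.Isolated → F.Component H
  | Sum.inl d => Quot.mk _ (F.vert d)
  | Sum.inr w => Quot.mk _ w.1

theorem arcComponent_walk [DecidableEq E] (H : Finset E) (x : (E × Bool) ⊕ F.Isolated) :
    F.arcComponent H (F.walk H x) = F.arcComponent H x := by
  rcases x with d | w
  · simp only [walk, Equiv.sumCongr_apply, Sum.map_inl, Equiv.trans_apply,
      Function.Involutive.coe_toPerm, arcComponent]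
    rw [← F.vert_rot d]
    generalize F.rot d = c
    obtain ⟨f, b⟩ := c
    by_cases hf : f ∈ H
    · have h : (Quot.mk _ (F.vert (f, false)) : F.Component H) = Quot.mk _ (F.vert (f, true)) :=
        Quot.sound ⟨f, hf, rfl, rfl⟩
      cases b <;> simp only [cross, hf, if_true, Bool.not_true, Bool.not_false, h]
    · simp only [cross, hf, if_false]
  · rfl

theorem arcComponent_eq_of_boundary [Finite V] [Finite E] [DecidableEq E] {H : Finset E}
    {x y : (E × Bool) ⊕ F.Isolated} (h : F.boundarySetoid H x y) :
    F.arcComponent H x = F.arcComponent H y := by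
  obtain ⟨n, -, rfl⟩ := Equiv.Perm.SameCycle.exists_pow_eq' h
  clear h
  induction n with
  | zero => rfl
  | succ n ih => rw [pow_succ', Equiv.Perm.mul_apply, arcComponent_walk, ← ih]

/-- A map from the components of a subfatgraph with one more edge. -/
def componentLift [DecidableEq E] {H : Finset E} {e : E} {α : Type*} (φ : F.Component H → α)
    (h : φ (Quot.mk _ (F.vert (e, false))) = φ (Quot.mk _ (F.vert (e, true)))) :
    F.Component (insert e H) → α :=
  Quot.lift (fun w => φ (Quot.mk _ w)) (by
    rintro _ _ ⟨f, hf, rfl, rfl⟩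
    rcases Finset.mem_insert.1 hf with rfl | hf
    · exact h
    · exact congrArg φ (Quot.sound ⟨f, hf, rfl, rfl⟩))

theorem card_component_le_of_eq [Finite V] [DecidableEq E] {H : Finset E} {e : E}
    (h : (Quot.mk _ (F.vert (e, false)) : F.Component H) = Quot.mk _ (F.vert (e, true))) :
    Nat.card (F.Component H) ≤ Nat.card (F.Component (insert e H)) := by
  refine Nat.card_le_card_of_surjective (F.componentLift id h) ?_
  rintro ⟨w⟩
  exact ⟨Quot.mk _ w, rfl⟩

/-- The new edge identifies at most two components. Redirecting the component `u` of one end to that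
of the other factors through the new components and misses at most `u`. -/
theorem card_component_le_add_one [Finite V] [DecidableEq E] (H : Finset E) (e : E) :
    Nat.card (F.Component H) ≤ Nat.card (F.Component (insert e H)) + 1 := by
  classical
  let u : F.Component H := Quot.mk _ (F.vert (e, false))
  let w : F.Component H := Quot.mk _ (F.vert (e, true))
  let φ : F.Component H → F.Component H := fun q => if q = u then w else q
  have hφ : φ u = φ w := by
    by_cases h : w = u <;> simp [φ, h]
  rw [← Finite.card_option]
  refine Nat.card_le_card_of_surjective
    (fun o : Option (F.Component (insert e H)) => o.elim u (F.componentLift φ hφ)) ?_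
  intro q
  by_cases hq : q = u
  · exact ⟨none, hq.symm⟩
  · obtain ⟨x, rfl⟩ := Quot.exists_rep q
    exact ⟨some (Quot.mk _ x), if_neg hq⟩

/-- Adding an edge does not decrease `2k + e - v - p`, twice the genus. -/
theorem euler_insert_le [Finite V] [Finite E] [DecidableEq E] {H : Finset E} {e : E}
    (he : e ∉ H) :
    2 * Nat.card (F.Component H) + H.card + Nat.card (F.Boundary (insert e H)) ≤
      2 * Nat.card (F.Component (insert e H)) + (insert e H).card + Nat.card (F.Boundary H) := by
  rw [Finset.card_insert_of_notMem he]
  -- Within one component, `k` does not drop and `p` grows by at most one, which `e` compensates.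
  -- Between two components, `k` drops by at most one, but the ends lie on different boundary
  -- circles, so `p` drops as well.
  by_cases h : (Quot.mk _ (F.vert (e, false)) : F.Component H) = Quot.mk _ (F.vert (e, true))
  · have h1 := F.card_component_le_of_eq h
    have h2 : Nat.card (F.Boundary (insert e H)) ≤ Nat.card (F.Boundary H) + 1 :=
      (F.isSaddle_insert he).card_le_card_add_one
    omega
  · have h1 := F.card_component_le_add_one H e
    have h2 : Nat.card (F.Boundary H) = Nat.card (F.Boundary (insert e H)) + 1 :=
      (F.isSaddle_insert he).card_add_one fun h' => h (F.arcComponent_eq_of_boundary h')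
    omega

theorem euler_mono [Finite V] [Finite E] [DecidableEq E] {H K : Finset E} (hHK : H ⊆ K) :
    2 * Nat.card (F.Component H) + H.card + Nat.card (F.Boundary K) ≤
      2 * Nat.card (F.Component K) + K.card + Nat.card (F.Boundary H) := by
  rw [← Finset.union_sdiff_of_subset hHK]
  induction K \ H using Finset.induction_on with
  | empty => simp
  | insert e D _ ih =>
    rw [Finset.union_insert]
    by_cases he : e ∈ H ∪ D
    · rwa [Finset.insert_eq_of_mem he]
    · have := F.euler_insert_le he
      omega

/-- Truncated subtraction and halving are monotone, so `euler_mono` suffices; neither parity nor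
nonnegativity of the Euler expression is needed. -/
theorem genus_eq_zero [Finite V] [Fintype E] [DecidableEq E] (h : F.genus Finset.univ = 0)
    (H : Finset E) : F.genus H = 0 := by
  have := F.euler_mono (Finset.subset_univ H)
  unfold genus at h ⊢
  omega

end Fatgraph

/-! ### The differentials preserve the degrees -/

theorem genusCoeff_degree {u u' : List Bool} (h : genusCoeff u u' ≠ 0) :
    (u.map pmDeg).sum = (u'.map pmDeg).sum := by
  unfold genusCoeff at h
  split_ifs at h with h1 h2 h2
  · rw [h2]
  · exact absurd rfl h
  · exact h2
  · exact absurd rfl h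

theorem rCoeff_degree {y z : List Bool} (h : rCoeff y z ≠ 0) :
    (y.map rDeg).sum = (z.map rDeg).sum := by
  unfold rCoeff at h
  split at h
  · rfl
  · split_ifs at h with h1
    · rw [h1.1, List.map_cons, List.map_cons, List.map_cons, List.sum_cons, List.sum_cons,
        List.sum_cons, ← h1.2, add_assoc]
    · exact absurd rfl h
  · exact absurd rfl h

theorem rCoeff_replicate (n : ℕ) :
    rCoeff (List.replicate n true) (List.replicate (n + 1) true) = 1 := by
  cases n with
  | zero => rfl
  | succ n => simp [List.replicate_succ, rCoeff, rDeg]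

/-- All degrees in `R` are nonpositive, so a total of zero leaves no room for `x₋₂`. -/
theorem eq_replicate_of_rDeg_sum {y : List Bool} (h : (y.map rDeg).sum = 0) :
    y = List.replicate y.length true := by
  rw [List.eq_replicate_iff]
  refine ⟨rfl, ?_⟩
  have hnonpos : ∀ z : List Bool, (z.map rDeg).sum ≤ 0 := fun z => by
    induction z with
    | nil => rfl
    | cons b z ih => cases b <;> simp [rDeg] <;> linarith
  induction y with
  | nil => simp
  | cons b y ih =>
    have := hnonpos y
    cases b
    · simp [rDeg] at h
      omega
    · simp [rDeg] at h
      simpa using ih h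

namespace SignedFatgraph

variable {V E : Type*} (F : SignedFatgraph V E)

theorem isSaddle_of_step [Finite V] [Finite E] [DecidableEq E] {e : E} {H H' : Finset E}
    (h : F.Step e H H') :
    IsSaddle (F.boundarySetoid H) (F.boundarySetoid H')
      (Sum.inl (e, false)) (Sum.inl (e, true)) := by
  rcases h with ⟨-, he, rfl⟩ | ⟨-, he, rfl⟩
  · exact F.isSaddle_erase he
  · exact F.isSaddle_insert he

/-- In terms of switched edges both kinds of step look alike, so the complex is an ordinary cube
whatever the signs. -/
theorem switched_of_step [Fintype E] [DecidableEq E] {e : E} {H H' : Finset E}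
    (h : F.Step e H H') : e ∉ F.switched H ∧ F.switched H' = insert e (F.switched H) := by
  constructor
  · rcases h with ⟨h1, h2, -⟩ | ⟨h1, h2, -⟩ <;> simp [switched, h1, h2]
  · ext f
    by_cases hf : f = e
    · subst hf
      rcases h with ⟨h1, h2, rfl⟩ | ⟨h1, h2, rfl⟩ <;> simp [switched, h1]
    · rcases h with ⟨h1, h2, rfl⟩ | ⟨h1, h2, rfl⟩ <;> simp [switched, hf]

theorem height_of_step [Fintype E] [DecidableEq E] {e : E} {H H' : Finset E}
    (h : F.Step e H H') : F.height H' = F.height H + 1 := by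
  obtain ⟨h1, h2⟩ := F.switched_of_step h
  rw [height, height, h2, Finset.card_insert_of_notMem h1]

variable [Fintype V] [Fintype E] [LinearOrder E]

theorem exists_of_coeff_ne_zero {x y : F.Gen} (h : F.complex.coeff x y ≠ 0) :
    ∃ e, F.Step e x.1 y.1 ∧ x.2.1 = y.2.1 ∧
      saddleCoeff (F.boundarySetoid x.1) (F.boundarySetoid y.1)
        (Sum.inl (e, false)) (Sum.inl (e, true)) x.2.2.1 y.2.2.1 ≠ 0 ∧
      genusCoeff x.2.2.2.1.toList y.2.2.2.1.toList ≠ 0 ∧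
      rCoeff x.2.2.2.2.toList y.2.2.2.2.toList ≠ 0 := by
  obtain ⟨e, -, he⟩ := Finset.exists_ne_zero_of_sum_ne_zero h
  split_ifs at he with h1 h2
  · exact ⟨e, h1, h2, by simp_all⟩
  · simp at he
  · exact absurd rfl he

/-- The saddle map lowers the first degree by one and the shift by the height raises it by one; the
maps on `U` and `R` preserve their degrees. -/
theorem degree_eq_of_coeff_ne_zero {x y : F.Gen} (h : F.complex.coeff x y ≠ 0) :
    F.complex.degree x = F.complex.degree y := by
  obtain ⟨e, h1, h2, h3, h4, h5⟩ := F.exists_of_coeff_ne_zero h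
  have hd := (F.isSaddle_of_step h1).degree_eq h3
  refine Prod.ext ?_ (Prod.ext (genusCoeff_degree h4) (rCoeff_degree h5))
  simp only [complex]
  have hh : (F.height y.1 : ℤ) = F.height x.1 + 1 := by exact_mod_cast F.height_of_step h1
  rw [h2, hd, hh]
  ring

end SignedFatgraph

/-! ### Chromatic homology -/

namespace GradedComplex

variable {G Λ Λ' K : Type*}

/-- The complex `C` with its internal degrees replaced by their images under `ψ`. -/
def coarsen (C : GradedComplex G Λ) (ψ : Λ → Λ') : GradedComplex G Λ' where
  height := C.height
  degree x := ψ (C.degree x)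
  coeff := C.coeff

/-- The complex `C` with an additional internal degree `κ`. -/
def refined (C : GradedComplex G Λ) (κ : G → K) : GradedComplex G (Λ × K) where
  height := C.height
  degree x := (C.degree x, κ x)
  coeff := C.coeff

end GradedComplex

namespace Fatgraph

variable {V E : Type*} (F : Fatgraph V E)

theorem switched_allNegative [Fintype E] [DecidableEq E] (H : Finset E) :
    F.allNegative.switched H = Hᶜ := by
  ext e
  simp [SignedFatgraph.switched, allNegative]

theorem height_allNegative [Fintype E] [DecidableEq E] (H : Finset E) :
    F.allNegative.height H = Fintype.card E - H.card := by
  rw [SignedFatgraph.height, switched_allNegative, Finset.card_compl]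

theorem step_allNegative [DecidableEq E] (e : E) (H H' : Finset E) :
    F.allNegative.Step e H H' ↔ e ∈ H ∧ H' = H.erase e := by
  simp [SignedFatgraph.Step, allNegative]

/-- The basis of the chromatic complex as a basis of the trigraded complex. -/
def chromaticGenToGen [Fintype E] [DecidableEq E] (x : F.ChromaticGen) : F.allNegative.Gen :=
  ⟨x.1, x.2.1, x.2.2.1, x.2.2.2.1, ⟨x.2.2.2.2.1, by
    rw [height_allNegative]
    exact x.2.2.2.2.2⟩⟩

theorem chromaticGenToGen_bijective [Fintype E] [DecidableEq E] :
    Function.Bijective F.chromaticGenToGen := by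
  constructor
  · rintro ⟨H, a, l, u, w, hw⟩ ⟨H', a', l', u', w', hw'⟩ h
    have h1 : H = H' := congrArg Sigma.fst h
    subst h1
    simp only [chromaticGenToGen, Sigma.mk.injEq, heq_eq_eq, true_and, Prod.mk.injEq] at h
    obtain ⟨rfl, rfl, rfl, rfl⟩ := h
    rfl
  · rintro ⟨H, a, l, u, w, hw⟩
    exact ⟨⟨H, a, l, u, w, by rw [hw, height_allNegative]⟩, rfl⟩

variable [Fintype V] [Fintype E] [LinearOrder E]

/-- When all edges are negative, the switched edges are the missing ones, so steps and signs agree.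
-/
theorem coeff_chromaticGenToGen (x y : F.ChromaticGen) :
    F.allNegative.complex.coeff (F.chromaticGenToGen x) (F.chromaticGenToGen y) =
      F.chromaticComplex.coeff x y := by
  classical
  simp only [SignedFatgraph.complex, chromaticComplex, GradedComplex.shift,
    chromaticComplexUnnormalized]
  refine Finset.sum_congr rfl fun e _ => ?_
  refine if_congr (F.step_allNegative _ _ _) ?_ rfl
  have : (F.allNegative.switched (F.chromaticGenToGen x).1).filter (fun f => f < e) =
      Finset.univ.filter (fun f => f < e ∧ f ∉ x.1) := by
    rw [switched_allNegative]
    ext f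
    simp [chromaticGenToGen, and_comm]
  rw [this]
  rfl

theorem chromaticHomologyEquiv (i j : ℤ) : Nonempty (F.ChromaticHomology i j ≃+
    DirectSum {t : ℤ × ℤ × ℤ // t.1 + t.2.1 + t.2.2 = j}
      (fun t => F.allNegative.HB (i + Fintype.card E) t.1.1 t.1.2.1 t.1.2.2)) := by
  let D := F.allNegative.complex.coarsen fun t : ℤ × ℤ × ℤ => t.1 + t.2.1 + t.2.2
  have hheight : ∀ x : F.ChromaticGen,
      ((F.allNegative.height x.1 : ℕ) : ℤ) = (Fintype.card E : ℤ) - x.1.card := fun x => by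
    rw [height_allNegative, Nat.cast_sub (Finset.card_le_univ _)]
  obtain ⟨f⟩ := GradedComplex.homologyEquiv_of_embedding F.chromaticComplex D j j
    (Fintype.card E) F.chromaticGenToGen F.chromaticGenToGen_bijective.1
    (fun x => by
      change ((F.allNegative.height x.1 : ℕ) : ℤ) =
        (Fintype.card E : ℤ) - x.1.card + -Fintype.card E + Fintype.card E
      rw [hheight]
      ring)
    (fun x => by
      refine Eq.congr_left ?_
      change (∑ w, pmDeg (x.2.1 w)) + (∑ᶠ c, pmDeg (x.2.2.1 c)) +
        (F.allNegative.height x.1 : ℕ) + (x.2.2.2.1.toList.map pmDeg).sum +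
        (x.2.2.2.2.toList.map rDeg).sum = (∑ w, pmDeg (x.2.1 w)) + (∑ᶠ c, pmDeg (x.2.2.1 c)) +
        (x.2.2.2.1.toList.map pmDeg).sum + (x.2.2.2.2.toList.map rDeg).sum +
        ((Fintype.card E : ℤ) - x.1.card) + 0
      rw [hheight]
      ring)
    (fun y _ => F.chromaticGenToGen_bijective.2 y)
    F.coeff_chromaticGenToGen
    (fun x y h => congrArg (fun t : ℤ × ℤ × ℤ => t.1 + t.2.1 + t.2.2)
      (F.allNegative.degree_eq_of_coeff_ne_zero h)) i _ rfl
  obtain ⟨g⟩ := GradedComplex.homologyEquiv_directSum F.allNegative.complex D rfl rfl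
    (fun x y h => F.allNegative.degree_eq_of_coeff_ne_zero h)
    (I := {t : ℤ × ℤ × ℤ // t.1 + t.2.1 + t.2.2 = j}) Subtype.val Subtype.val_injective
    (i + Fintype.card E) j (fun x => by simp [D, GradedComplex.coarsen])
  exact ⟨f.trans g⟩

end Fatgraph

/-! ### The link associated with a signed fatgraph of genus zero -/

namespace SignedFatgraph

variable {V E : Type*} [DecidableEq E] (F : SignedFatgraph V E)

theorem linkGlue_link_after (d : E × Bool) : F.link.glue (F.after d) = F.before (F.rot d) :=
  F.linkGlue_after d

theorem linkGlue_link_before (d : E × Bool) :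
    F.link.glue (F.before d) = F.after (F.rot.symm d) :=
  F.linkGlue_before d

/-- The state in which the `1`-smoothed crossings are the switched edges of `H`. -/
def IsStateOf [Fintype E] (s : E → Bool) (H : Finset E) : Prop :=
  ∀ e, s e = true ↔ e ∈ F.switched H

/-- The twist is chosen so that, for either sign, the smoothing follows the bridge when the edge is
in `H` and cuts it otherwise. -/
theorem smooth_before [Fintype E] {s : E → Bool} {H : Finset E} (h : F.IsStateOf s H)
    (d : E × Bool) :
    (d.1, LinkDiagram.smooth (s d.1) (F.before d).2) = F.after (Fatgraph.cross H d) := by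
  obtain ⟨e, b⟩ := d
  have := h e
  by_cases hp : e ∈ F.positive <;> by_cases hH : e ∈ H <;>
    simp only [switched, hp, hH, Finset.mem_filter, Finset.mem_univ, not_true,
      not_false_iff, and_true, and_false, or_true, or_false, iff_true, iff_false, and_self,
      Bool.not_eq_true] at this <;>
    cases b <;>
    simp [this, before, after, twist, Fatgraph.cross, hp, hH, LinkDiagram.smooth]

theorem smooth_after [Fintype E] {s : E → Bool} {H : Finset E} (h : F.IsStateOf s H)
    (d : E × Bool) :
    (d.1, LinkDiagram.smooth (s d.1) (F.after d).2) = F.before (Fatgraph.cross H d) := by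
  obtain ⟨e, b⟩ := d
  have := h e
  by_cases hp : e ∈ F.positive <;> by_cases hH : e ∈ H <;>
    simp only [switched, hp, hH, Finset.mem_filter, Finset.mem_univ, not_true,
      not_false_iff, and_true, and_false, or_true, or_false, iff_true, iff_false, and_self,
      Bool.not_eq_true] at this <;>
    cases b <;>
    simp [this, before, after, twist, Fatgraph.cross, hp, hH, LinkDiagram.smooth]

/-! ### Boundary components as circles of a state -/

/-- The end of a crossing at which an arc of an island begins; a crossingless circle for an
isolated vertex. -/
def arcEnd : (E × Bool) ⊕ F.Isolated → (E × Fin 4) ⊕ F.Isolated :=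
  Sum.map F.after id

/-- The arc of an island on which an end of a crossing lies. -/
def endArc : (E × Fin 4) ⊕ F.Isolated → (E × Bool) ⊕ F.Isolated
  | Sum.inl a => Sum.inl <| match a.2 - F.twist a.1 with
    | 0 => (a.1, false)
    | 1 => F.rot.symm (a.1, false)
    | 2 => (a.1, true)
    | 3 => F.rot.symm (a.1, true)
  | Sum.inr w => Sum.inr w

theorem endArc_after (d : E × Bool) : F.endArc (Sum.inl (F.after d)) = Sum.inl d := by
  obtain ⟨e, b⟩ := d
  cases b <;> simp [endArc, after]

theorem endArc_before (d : E × Bool) :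
    F.endArc (Sum.inl (F.before d)) = Sum.inl (F.rot.symm d) := by
  obtain ⟨e, b⟩ := d
  cases b <;> simp [endArc, before]

theorem endArc_arcEnd (x : (E × Bool) ⊕ F.Isolated) : F.endArc (F.arcEnd x) = x := by
  rcases x with d | w
  · exact F.endArc_after d
  · rfl

theorem walk_inl (H : Finset E) (d : E × Bool) :
    F.walk H (Sum.inl d) = Sum.inl (Fatgraph.cross H (F.rot d)) := rfl

theorem boundary_walk (H : Finset E) (x : (E × Bool) ⊕ F.Isolated) :
    F.boundarySetoid H x (F.walk H x) :=
  Equiv.Perm.SameCycle.rfl.apply_right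

theorem circle_arcEnd_endArc (s : E → Bool) (a : (E × Fin 4) ⊕ F.Isolated) :
    F.link.circleSetoid s a (F.arcEnd (F.endArc a)) := by
  rcases a with a | w
  · obtain ⟨d, rfl | rfl⟩ := F.eq_after_or_before a
    · rw [endArc_after]
      exact (F.link.circleSetoid s).refl _
    · rw [endArc_before]
      have := LinkDiagram.Joined.arc (C := F.Isolated) (L := F.link) (s := s) (F.before d)
      rw [linkGlue_link_before] at this
      exact Relation.EqvGen.rel _ _ this
  · exact (F.link.circleSetoid s).refl _

/-- One step of the boundary walk is an arc of the diagram followed by a smoothing. -/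
theorem circle_walk [Fintype E] {s : E → Bool} {H : Finset E} (h : F.IsStateOf s H)
    (x : (E × Bool) ⊕ F.Isolated) :
    F.link.circleSetoid s (F.arcEnd x) (F.arcEnd (F.walk H x)) := by
  rcases x with d | w
  · have h1 := LinkDiagram.Joined.arc (C := F.Isolated) (L := F.link) (s := s) (F.after d)
    rw [linkGlue_link_after] at h1
    have h2 := LinkDiagram.Joined.smoothing (C := F.Isolated) (L := F.link) (s := s)
      (F.rot d).1 (F.before (F.rot d)).2
    rw [F.smooth_before h] at h2
    exact Relation.EqvGen.trans _ _ _ (Relation.EqvGen.rel _ _ h1) (Relation.EqvGen.rel _ _ h2)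
  · exact (F.link.circleSetoid s).refl _

theorem circle_of_boundary [Finite V] [Fintype E] {s : E → Bool} {H : Finset E}
    (h : F.IsStateOf s H) {x y : (E × Bool) ⊕ F.Isolated} (hxy : F.boundarySetoid H x y) :
    F.link.circleSetoid s (F.arcEnd x) (F.arcEnd y) := by
  obtain ⟨n, -, rfl⟩ := Equiv.Perm.SameCycle.exists_pow_eq' hxy
  clear hxy
  induction n with
  | zero => exact (F.link.circleSetoid s).refl _
  | succ n ih =>
    rw [pow_succ', Equiv.Perm.mul_apply]
    exact (F.link.circleSetoid s).trans ih (F.circle_walk h _)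

theorem boundary_of_joined [Fintype E] {s : E → Bool} {H : Finset E} (h : F.IsStateOf s H)
    {a b : (E × Fin 4) ⊕ F.Isolated} (hab : F.link.Joined s a b) :
    F.boundarySetoid H (F.endArc a) (F.endArc b) := by
  have hwalk : ∀ d, F.boundarySetoid H (Sum.inl (F.rot.symm d))
      (Sum.inl (Fatgraph.cross H d)) := fun d => by
    have := F.boundary_walk H (Sum.inl (F.rot.symm d))
    rwa [walk_inl, Equiv.apply_symm_apply] at this
  cases hab with
  | arc a =>
    obtain ⟨d, rfl | rfl⟩ := F.eq_after_or_before a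
    · rw [linkGlue_link_after, endArc_after, endArc_before, Equiv.symm_apply_apply]
    · rw [linkGlue_link_before, endArc_after, endArc_before]
  | smoothing x k =>
    obtain ⟨d, hd | hd⟩ := F.eq_after_or_before (x, k)
    · have h1 : x = d.1 := congrArg Prod.fst hd
      have h2 : k = (F.after d).2 := congrArg Prod.snd hd
      rw [hd, h1, h2, F.smooth_after h, endArc_after, endArc_before]
      have := hwalk (Fatgraph.cross H d)
      rw [Fatgraph.cross_involutive] at this
      exact (F.boundarySetoid H).symm this
    · have h1 : x = d.1 := congrArg Prod.fst hd
      have h2 : k = (F.before d).2 := congrArg Prod.snd hd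
      rw [hd, h1, h2, F.smooth_before h, endArc_after, endArc_before]
      exact hwalk d

theorem boundary_of_circle [Fintype E] {s : E → Bool} {H : Finset E} (h : F.IsStateOf s H)
    {a b : (E × Fin 4) ⊕ F.Isolated} (hab : F.link.circleSetoid s a b) :
    F.boundarySetoid H (F.endArc a) (F.endArc b) := by
  induction hab with
  | rel a b hab => exact F.boundary_of_joined h hab
  | refl a => exact (F.boundarySetoid H).refl _
  | symm a b _ ih => exact (F.boundarySetoid H).symm ih
  | trans a b c _ _ ih ih' => exact (F.boundarySetoid H).trans ih ih'

/-- The boundary components of `H` are the circles of the corresponding state of the link. -/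
def boundaryEquivCircle [Finite V] [Fintype E] {s : E → Bool} {H : Finset E}
    (h : F.IsStateOf s H) : F.Boundary H ≃ F.link.Circle s where
  toFun := Quotient.map' F.arcEnd fun _ _ => F.circle_of_boundary h
  invFun := Quotient.map' F.endArc fun _ _ => F.boundary_of_circle h
  left_inv := by
    rintro ⟨x⟩
    exact congrArg (Quotient.mk _) (F.endArc_arcEnd x)
  right_inv := by
    rintro ⟨a⟩
    exact Quotient.sound ((F.link.circleSetoid s).symm (F.circle_arcEnd_endArc s a))

/-! ### States and spanning subfatgraphs -/

/-- The spanning subfatgraph that corresponds to a state. -/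
def ofState [Fintype E] (s : E → Bool) : Finset E :=
  Finset.univ.filter fun e => e ∈ F.positive ↔ s e = true

theorem isStateOf_ofState [Fintype E] (s : E → Bool) : F.IsStateOf s (F.ofState s) := by
  intro e
  by_cases hp : e ∈ F.positive <;> simp [switched, ofState, hp]

theorem ofState_bijective [Fintype E] : Function.Bijective F.ofState := by
  constructor
  · intro s s' h
    funext e
    rw [Bool.eq_iff_iff, F.isStateOf_ofState s e, h, ← F.isStateOf_ofState s' e]
  · intro H
    refine ⟨fun e => decide (e ∈ F.switched H), ?_⟩
    ext e
    by_cases hp : e ∈ F.positive <;> simp [switched, ofState, hp]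

theorem step_ofState [Fintype E] (e : E) (s s' : E → Bool) :
    F.Step e (F.ofState s) (F.ofState s') ↔ s e = false ∧ s' = Function.update s e true := by
  have hmem : ∀ (s : E → Bool) f, f ∈ F.ofState s ↔ (f ∈ F.positive ↔ s f = true) := fun s f => by
    simp [ofState]
  constructor
  · intro h
    obtain ⟨h1, h2⟩ := F.switched_of_step h
    rw [← F.isStateOf_ofState s e] at h1
    refine ⟨by simpa using h1, funext fun f => ?_⟩
    rw [Bool.eq_iff_iff, F.isStateOf_ofState s' f, h2, Finset.mem_insert,
      ← F.isStateOf_ofState s f]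
    by_cases hf : f = e
    · subst hf
      simp
    · simp [hf]
  · rintro ⟨h1, rfl⟩
    by_cases hp : e ∈ F.positive
    · refine Or.inr ⟨hp, by simp [hmem, hp, h1], ?_⟩
      ext f
      by_cases hf : f = e
      · subst hf
        simp [hmem, hp]
      · simp [hmem, hf]
    · refine Or.inl ⟨hp, by simp [hmem, hp, h1], ?_⟩
      ext f
      by_cases hf : f = e
      · subst hf
        simp [hmem, hp]
      · simp [hmem, hf]

theorem circle_smooth (s : E → Bool) (x : E) (k k' : Fin 4)
    (h : LinkDiagram.smooth (s x) k = k') :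
    F.link.circleSetoid s (Sum.inl (x, k)) (Sum.inl (x, k')) :=
  h ▸ Relation.EqvGen.rel _ _ (LinkDiagram.Joined.smoothing x k)

theorem saddleCoeff_link [Finite V] [Fintype E] {s s' : E → Bool} {e : E} (hs : s e = false)
    (hs' : s' = Function.update s e true) (l : F.link.Circle s → Bool)
    (l' : F.link.Circle s' → Bool) :
    saddleCoeff (F.boundarySetoid (F.ofState s)) (F.boundarySetoid (F.ofState s'))
        (Sum.inl (e, false)) (Sum.inl (e, true))
        (l ∘ F.boundaryEquivCircle (F.isStateOf_ofState s))
        (l' ∘ F.boundaryEquivCircle (F.isStateOf_ofState s')) =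
      saddleCoeff (F.link.circleSetoid s) (F.link.circleSetoid s')
        (Sum.inl (e, 0)) (Sum.inl (e, 2)) l l' := by
  have hs1 : s' e = true := by simp [hs']
  have hsaddle := F.isSaddle_of_step ((F.step_ofState e s s').2 ⟨hs, hs'⟩)
  -- For a positive edge the marked arcs begin at the ends `0` and `2`. For a negative one they
  -- begin at `1` and `3`, which the `0`-smoothing joins to `0` and `2`, but the `1`-smoothing to
  -- `2` and `0`: the new circles are exchanged.
  refine saddleCoeff_comap F.arcEnd _ _ (fun _ => rfl) (fun _ => rfl) ?_ ?_ ?_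
    hsaddle.not_rel_iff.1
    (fun d => ⟨_, F.circle_arcEnd_endArc s d, F.circle_arcEnd_endArc s' d⟩) l l'
  · by_cases hp : e ∈ F.positive
    · simp [arcEnd, after, twist, hp]
    · refine F.circle_smooth s e _ _ ?_
      simp [hs, twist, hp, LinkDiagram.smooth]
  · by_cases hp : e ∈ F.positive
    · simp [arcEnd, after, twist, hp]
    · refine F.circle_smooth s e _ _ ?_
      simp [hs, twist, hp, LinkDiagram.smooth]
  · by_cases hp : e ∈ F.positive
    · refine Or.inl ⟨?_, ?_⟩ <;>
        simp [arcEnd, after, twist, hp]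
    · refine Or.inr ⟨?_, ?_⟩ <;>
      · refine F.circle_smooth s' e _ _ ?_
        simp [hs1, twist, hp, LinkDiagram.smooth]

end SignedFatgraph

/-! ### Khovanov homology from the trigraded homology -/

namespace SignedFatgraph

variable {V E : Type*} [Fintype E] [LinearOrder E] (F : SignedFatgraph V E)

theorem height_ofState (s : E → Bool) :
    F.height (F.ofState s) = LinkDiagram.height s := by
  rw [height, LinkDiagram.height]
  refine congrArg _ ?_
  ext e
  rw [← F.isStateOf_ofState s e]
  simp

variable [Fintype V]

/-- The basis element of the trigraded complex given by a basis element of the Khovanov complex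
and one of `V^{⊗ v}`. -/
noncomputable def genOfKhGen (a : V → Bool) (x : F.link.KhGen) : F.Gen :=
  ⟨F.ofState x.1, a, x.2 ∘ F.boundaryEquivCircle (F.isStateOf_ofState x.1),
    List.Vector.replicate _ true, List.Vector.replicate _ true⟩

theorem genOfKhGen_injective (a : V → Bool) : Function.Injective (F.genOfKhGen a) := by
  rintro ⟨s, l⟩ ⟨s', l'⟩ h
  have hs : s = s' := F.ofState_bijective.1 (congrArg Sigma.fst h)
  subst hs
  simp only [genOfKhGen, Sigma.mk.injEq, heq_eq_eq, true_and, Prod.mk.injEq, and_true] at h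
  rw [(Equiv.surjective _).injective_comp_right h]

theorem coeff_genOfKhGen (hF : F.genus Finset.univ = 0) (a : V → Bool) (x y : F.link.KhGen) :
    F.complex.coeff (F.genOfKhGen a x) (F.genOfKhGen a y) =
      F.link.khovanovUnnormalized.coeff x y := by
  classical
  obtain ⟨s, l⟩ := x
  obtain ⟨s', l'⟩ := y
  simp only [complex, LinkDiagram.khovanovUnnormalized, genOfKhGen]
  refine Finset.sum_congr rfl fun e _ => ?_
  by_cases h : s e = false ∧ s' = Function.update s e true
  · have hstep := (F.step_ofState e s s').2 h
    rw [if_pos hstep, if_pos h]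
    have h1 : (F.switched (F.ofState s)).filter (fun f => f < e) =
        Finset.univ.filter (fun f => f < e ∧ s f = true) := by
      ext f
      rw [Finset.mem_filter, ← F.isStateOf_ofState s f]
      simp [and_comm]
    have h2 : genusCoeff (List.Vector.replicate (2 * F.genus (F.ofState s)) true).toList
        (List.Vector.replicate (2 * F.genus (F.ofState s')) true).toList = 1 := by
      rw [F.genus_eq_zero hF, F.genus_eq_zero hF]
      rfl
    have h3 : rCoeff (List.Vector.replicate (F.height (F.ofState s)) true).toList
        (List.Vector.replicate (F.height (F.ofState s')) true).toList = 1 := by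
      rw [F.height_of_step hstep]
      exact rCoeff_replicate _
    simp only [h1, h2, h3, F.saddleCoeff_link h.1 h.2, if_true, mul_one]
  · rw [if_neg h, if_neg fun h' => h ((F.step_ofState e s s').1 h')]

theorem degree_genOfKhGen (hF : F.genus Finset.univ = 0) (a : V → Bool) (x : F.link.KhGen) :
    F.complex.degree (F.genOfKhGen a x) =
      (∑ w, pmDeg (a w) + F.link.khovanovUnnormalized.degree x, 0, 0) := by
  refine Prod.ext ?_ (Prod.ext ?_ ?_)
  · simp only [complex, genOfKhGen, LinkDiagram.khovanovUnnormalized, height_ofState]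
    rw [add_assoc]
    congr 2
    exact finsum_comp_equiv (F.boundaryEquivCircle (F.isStateOf_ofState x.1))
      (f := fun c => pmDeg (x.2 c))
  · change ((List.replicate (2 * F.genus (F.ofState x.1)) true).map pmDeg).sum = 0
    rw [F.genus_eq_zero hF]
    rfl
  · change ((List.replicate _ true).map rDeg).sum = 0
    simp [rDeg]

/-- Genus zero makes the `U`-word empty, and third degree zero leaves only the `R`-word of all `x₀`.
-/
theorem mem_range_genOfKhGen (hF : F.genus Finset.univ = 0) (y : F.Gen)
    (hy : (F.complex.degree y).2.2 = 0) : y ∈ Set.range (F.genOfKhGen y.2.1) := by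
  obtain ⟨H, a, l, u, w⟩ := y
  obtain ⟨s, rfl⟩ := F.ofState_bijective.2 H
  refine ⟨⟨s, l ∘ (F.boundaryEquivCircle (F.isStateOf_ofState s)).symm⟩, ?_⟩
  have hu : u = List.Vector.replicate _ true := by
    have : 2 * F.genus (F.ofState s) = 0 := by rw [F.genus_eq_zero hF]
    refine List.Vector.eq _ _ ?_
    rw [List.eq_nil_of_length_eq_zero (u.toList_length.trans this),
      List.eq_nil_of_length_eq_zero ((List.Vector.toList_length _).trans this)]
  have hw : w = List.Vector.replicate _ true := by
    refine List.Vector.eq _ _ ?_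
    have := eq_replicate_of_rDeg_sum hy
    rw [List.Vector.toList_length] at this
    exact this
  subst hu hw
  simp only [genOfKhGen, Function.comp_assoc, Equiv.symm_comp_self, Function.comp_id]

/-- The summand of `HB` that belongs to a fixed basis element of `V^{⊗ v}`. -/
theorem homologyEquiv_refined (hF : F.genus Finset.univ = 0) (o : F.link.Orientation) (i j : ℤ)
    (a : V → Bool) : Nonempty ((F.complex.refined fun x => x.2.1).Homology i ((j, 0, 0), a) ≃+
      F.link.HK o (i - o.nNeg) (j - ∑ w, pmDeg (a w) + o.nPos - 2 * o.nNeg)) := by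
  -- The orientation enters only through the normalization: the heights differ by `n₋`, and the
  -- fixed element `a` contributes its degree to `j`.
  refine (GradedComplex.homologyEquiv_of_embedding
    (F.link.khovanovUnnormalized.shift (-(o.nNeg : ℤ)) ((o.nPos : ℤ) - 2 * o.nNeg))
    (F.complex.refined fun x => x.2.1) _ ((j, 0, 0), a) o.nNeg (F.genOfKhGen a)
    (F.genOfKhGen_injective a) (fun x => ?_) (fun x => ?_) (fun y hy => ?_)
    (F.coeff_genOfKhGen hF a) (fun x y hxy => ?_) _ i (by ring)).map AddEquiv.symm
  · change ((F.height (F.ofState x.1) : ℕ) : ℤ) = (LinkDiagram.height x.1 : ℕ) + -o.nNeg + o.nNeg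
    rw [height_ofState]
    ring
  · have h1 : (F.complex.refined fun x => x.2.1).degree (F.genOfKhGen a x) =
        ((∑ w, pmDeg (a w) + F.link.khovanovUnnormalized.degree x, 0, 0), a) :=
      Prod.ext (F.degree_genOfKhGen hF a x) rfl
    have h2 : (F.link.khovanovUnnormalized.shift (-(o.nNeg : ℤ))
        ((o.nPos : ℤ) - 2 * o.nNeg)).degree x =
        F.link.khovanovUnnormalized.degree x + ((o.nPos : ℤ) - 2 * o.nNeg) := rfl
    rw [h1, h2]
    simp only [Prod.mk.injEq, and_true]
    constructor <;> intro h <;> linarith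
  · obtain ⟨h1, h2⟩ := Prod.ext_iff.1 hy
    subst h2
    exact F.mem_range_genOfKhGen hF y (congrArg (fun t => t.2.2) h1)
  · obtain ⟨e, -, h1, -⟩ := F.exists_of_coeff_ne_zero hxy
    exact Prod.ext (F.degree_eq_of_coeff_ne_zero hxy) h1

/-- For genus zero, `HB` in degree `(j, 0, 0)` is a sum of shifted Khovanov homology groups. -/
theorem hbEquiv_pi_hk (hF : F.genus Finset.univ = 0) (o : F.link.Orientation) (i j : ℤ) :
    Nonempty (F.HB i j 0 0 ≃+ ((a : V → Bool) →
      F.link.HK o (i - o.nNeg) (j - ∑ w, pmDeg (a w) + o.nPos - 2 * o.nNeg))) := by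
  classical
  obtain ⟨f⟩ := GradedComplex.homologyEquiv_directSum (F.complex.refined fun x => x.2.1)
    F.complex rfl rfl
    (fun x y hxy => by
      obtain ⟨e, -, h1, -⟩ := F.exists_of_coeff_ne_zero hxy
      exact Prod.ext (F.degree_eq_of_coeff_ne_zero hxy) h1)
    (fun a : V → Bool => (((j, 0, 0) : ℤ × ℤ × ℤ), a)) (fun a b h => congrArg Prod.snd h) i
    (j, 0, 0) (fun x => by simp [GradedComplex.refined])
  -- There are finitely many basis elements of `V^{⊗ v}`, so the direct sum is a product.
  exact ⟨f.trans <| (DirectSum.addEquivProd _).trans <|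
    AddEquiv.piCongrRight fun a => (F.homologyEquiv_refined hF o i j a).some⟩

/-- The complex has a finite basis, hence a top degree. This starts the downward induction. -/
theorem exists_hk_subsingleton (o : F.link.Orientation) : ∃ N : ℤ, ∀ i m : ℤ, N < m →
    Subsingleton (F.link.HK o i (m + o.nPos - 2 * o.nNeg)) := by
  obtain ⟨N, hN⟩ := (Set.finite_range F.link.khovanovUnnormalized.degree).bddAbove
  refine ⟨N, fun i m hm => GradedComplex.homology_subsingleton_of_degree_ne _ _ _ fun x hx => ?_⟩
  have h1 : F.link.khovanovUnnormalized.degree x ≤ N := hN ⟨x, rfl⟩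
  have h2 : F.link.khovanovUnnormalized.degree x + ((o.nPos : ℤ) - 2 * o.nNeg) =
    m + o.nPos - 2 * o.nNeg := hx
  linarith

end SignedFatgraph

/-! ### Recovering Khovanov homology from the shifted sums -/

theorem GradedComplex.homology_fg {G Λ : Type*} [Fintype G] (C : GradedComplex G Λ) (i : ℤ)
    (t : Λ) : AddGroup.FG (C.Homology i t) :=
  Module.Finite.iff_addGroup_fg.1 inferInstance

/-- The element `v₊ ⊗ ⋯ ⊗ v₊` alone has top degree, which makes the recursion solvable. -/
theorem sum_pmDeg_lt {V : Type*} [Fintype V] (a : V → Bool) (ha : a ≠ fun _ => true) :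
    ∑ w, pmDeg (a w) < ∑ _w : V, pmDeg true := by
  obtain ⟨w, hw⟩ := Function.ne_iff.1 ha
  refine Finset.sum_lt_sum (fun w _ => ?_) ⟨w, Finset.mem_univ w, ?_⟩
  · cases a w <;> simp [pmDeg]
  · rw [Bool.not_eq_true _ |>.mp hw]
    simp [pmDeg]

/-- Products of a family of groups over weights depend only on the multiset of the weights. -/
theorem nonempty_addEquiv_pi_reindex {I I' : Type*} (ε : I ≃ I') (wt : I → ℤ) (wt' : I' → ℤ)
    (h : ∀ a, wt' (ε a) = wt a) (M : ℤ → Type*) [∀ m, AddCommGroup (M m)] :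
    Nonempty ((∀ b, M (wt' b)) ≃+ ∀ a, M (wt a)) := by
  obtain rfl : (fun a => wt' (ε a)) = wt := funext h
  exact ⟨{ (Equiv.piCongrLeft (fun b => M (wt' b)) ε).symm with map_add' := fun _ _ => rfl }⟩

theorem hkEquiv_of_hbEquiv {V E V' E' : Type*} [Fintype V] [Fintype E] [LinearOrder E]
    [Fintype V'] [Fintype E'] [LinearOrder E'] (F : SignedFatgraph V E)
    (F' : SignedFatgraph V' E') (hF : F.genus Finset.univ = 0) (hF' : F'.genus Finset.univ = 0)
    (hV : Fintype.card V = Fintype.card V')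
    (h : ∀ i j k l : ℤ, Nonempty (F.HB i j k l ≃+ F'.HB i j k l))
    (o : F.link.Orientation) (o' : F'.link.Orientation) (i j : ℤ) :
    Nonempty (F.link.HK o (i - o.nNeg) (j + o.nPos - 2 * o.nNeg) ≃+
      F'.link.HK o' (i - o'.nNeg) (j + o'.nPos - 2 * o'.nNeg)) := by
  obtain ⟨N, hN⟩ := F.exists_hk_subsingleton o
  obtain ⟨N', hN'⟩ := F'.exists_hk_subsingleton o'
  have hfg : ∀ m, AddGroup.FG (F.link.HK o (i - o.nNeg) (m + o.nPos - 2 * o.nNeg)) :=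
    fun m => GradedComplex.homology_fg _ _ _
  have hfg' : ∀ m, AddGroup.FG (F'.link.HK o' (i - o'.nNeg) (m + o'.nPos - 2 * o'.nNeg)) :=
    fun m => GradedComplex.homology_fg _ _ _
  refine nonempty_addEquiv_of_pi_shift (fun a : V → Bool => ∑ w, pmDeg (a w)) (fun _ => true)
    sum_pmDeg_lt (fun m => F.link.HK o (i - o.nNeg) (m + o.nPos - 2 * o.nNeg))
    (fun m => F'.link.HK o' (i - o'.nNeg) (m + o'.nPos - 2 * o'.nNeg)) (max N N')
    (fun m hm => hN _ m ((le_max_left _ _).trans_lt hm))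
    (fun m hm => hN' _ m ((le_max_right _ _).trans_lt hm)) (fun j => ?_) j
  obtain ⟨f⟩ := F.hbEquiv_pi_hk hF o i j
  obtain ⟨f'⟩ := F'.hbEquiv_pi_hk hF' o' i j
  obtain ⟨g⟩ := h i j 0 0
  -- Any bijection of the vertices will do: it only has to match the degrees of the two bases of
  -- `V^{⊗ v}`.
  let ε := Fintype.equivOfCardEq hV
  obtain ⟨r⟩ := nonempty_addEquiv_pi_reindex (ε.arrowCongr (Equiv.refl Bool))
    (fun a => j - ∑ w, pmDeg (a w)) (fun b => j - ∑ w, pmDeg (b w))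
    (fun a => congrArg (j - ·) (Equiv.sum_comp ε.symm fun w => pmDeg (a w)))
    (fun m => F'.link.HK o' (i - o'.nNeg) (m + o'.nPos - 2 * o'.nNeg))
  exact ⟨f.symm.trans <| g.trans <| f'.trans r⟩

theorem theorem5p4 {V E : Type*} [Fintype V] [Fintype E] [LinearOrder E] :
    -- Khovanov homology of the link associated with a plane signed fatgraph, in terms of `HB`:
    -- `HB^i_{(j,0,0)} = ⨁_{p+q=j} HK^{i-n₋}_{p+n₊-2n₋}(L) ⊗ (V^{⊗ v})_q`
    (∀ F : SignedFatgraph V E, F.genus Finset.univ = 0 → ∀ o : F.link.Orientation, ∀ i j : ℤ,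
      Nonempty (F.HB i j 0 0 ≃+ ((a : V → Bool) →
        F.link.HK o (i - o.nNeg) (j - ∑ w, pmDeg (a w) + o.nPos - 2 * o.nNeg)))) ∧
    -- `HB` and the number of vertices determine it, up to the normalization by `n₊` and `n₋`
    (∀ {V' E' : Type*} [Fintype V'] [Fintype E'] [LinearOrder E']
      (F : SignedFatgraph V E) (F' : SignedFatgraph V' E'),
      F.genus Finset.univ = 0 → F'.genus Finset.univ = 0 →
      Fintype.card V = Fintype.card V' →
      (∀ i j k l : ℤ, Nonempty (F.HB i j k l ≃+ F'.HB i j k l)) →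
      ∀ (o : F.link.Orientation) (o' : F'.link.Orientation) (i j : ℤ),
        Nonempty (F.link.HK o (i - o.nNeg) (j + o.nPos - 2 * o.nNeg) ≃+
          F'.link.HK o' (i - o'.nNeg) (j + o'.nPos - 2 * o'.nNeg))) ∧
    -- chromatic homology of an arbitrary fatgraph: all edges negative, total degree
    (∀ (F : Fatgraph V E) (i j : ℤ),
      Nonempty (F.ChromaticHomology i j ≃+
        DirectSum {t : ℤ × ℤ × ℤ // t.1 + t.2.1 + t.2.2 = j}
          (fun t => F.allNegative.HB (i + Fintype.card E) t.1.1 t.1.2.1 t.1.2.2))) := by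
  refine ⟨fun F hF o i j => F.hbEquiv_pi_hk hF o i j, ?_, fun F i j => F.chromaticHomologyEquiv i j⟩
  intro V' E' _ _ _ F F' hF hF' hV h o o' i j
  exact hkEquiv_of_hbEquiv F F' hF hF' hV h o o' i j
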